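/- Let $\mathbb K$ be $\mathbb R$ or $\mathbb C$, let $(X,d)$ be a metric space with a base point $0$, and put $\widetilde X=\{(x,y)\in X\times X: x\ne y\}$. All vector spaces are over $\mathbb K$. **Lipschitz spaces.** For a Banach space $F$, let $\mathrm{Lip}_0(X,F)$ be the space of all Lipschitz maps $f\colon X\to F$ with $f(0)=0$, with the norm $\mathrm{Lip}(f)=\sup\{\|f(x)-f(y)\|/d(x,y):(x,y)\in\widetilde X\}$ (equal to $0$ if $\widetilde X=\emptyset$), and let $\mathrm{Lip}_0(X)=\mathrm{Lip}_0(X,\mathbb K)$, with closed unit ball $B$. The Lipschitz-free space $\mathcal F(X)$ is the norm-closed linear span, in the normed dual of $\mathrm{Lip}_0(X)$, of the functionals $\delta_x\colon f\mapsto f(x)$, $x\in X$. Let $\mathrm{Lip}_{0F}(X,F)$ be the set of all $f\in\mathrm{Lip}_0(X,F)$ such that the linear span of $f(X)$ is finite-dimensional (the Lipschitz finite-rank operators). **Topologies.** Let $\tau_0$ be the compact-open topology on $\mathrm{Lip}_0(X)$. The topology $\tau_\gamma$ on $\mathrm{Lip}_0(X)$ is the mixed topology $\gamma[\mathrm{Lip},\tau_0]$: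 the locally convex topology having as a base of neighbourhoods of zero the sets $$\gamma(U)=\bigcup_{n\ge1}\bigl(U_1\cap B+U_2\cap 2B+\dots+U_n\cap 2^{n-1}B\bigr),$$ where $U=(U_n)_{n\ge1}$ runs over the sequences of convex balanced $\tau_0$-neighbourhoods of zero. The topology $\gamma\tau_\gamma$ on $\mathrm{Lip}_0(X,F)$ is the locally convex topology generated by the seminorms $$q(f)=\sup_{n}\alpha_n\frac{\|f(x_n)-f(y_n)\|}{d(x_n,y_n)},$$ where $(\alpha_n)$ runs over the sequences of positive reals tending to $0$ and $((x_n,y_n))$ over the sequences in $\widetilde X$ (the space is $\{0\}$ when $\widetilde X=\emptyset$). **Approximation property and $\varepsilon$-product.** For locally convex Hausdorff spaces $E,G$, let $\mathcal L_c(E;G)$ be the space of continuous linear maps $E\to G$ with the topology of uniform convergence on the convex balanced compact subsets of $E$, and let $E'_c=\mathcal L_c(E;\mathbb K)$. The space $E$ has the approximation property (AP) if the identity of $E$ lies in the closure, in $\mathcal L_c(E;E)$, of the set of continuous linear maps of finite rank. The $\varepsilon$-product $E\,\varepsilon\,G$ is the space of continuous linear maps $G'_c\to E$ with the topology of uniform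 convergence on the equicontinuous subsets of $G'$; the tensor product $E\otimes G$ is mapped into it by $e\otimes y\mapsto(\varphi\mapsto\varphi(y)e)$. **Theorem.** The following are equivalent. 1. $(\mathrm{Lip}_0(X),\tau_\gamma)$ has the (AP). 2. $\mathcal F(X)$ has the (AP). 3. For every Banach space $F$, the image of $\mathrm{Lip}_0(X)\otimes F$ is dense in $(\mathrm{Lip}_0(X),\tau_\gamma)\,\varepsilon\,F$. 4. For every Banach space $F$, $\mathrm{Lip}_{0F}(X,F)$ is dense in $(\mathrm{Lip}_0(X,F),\gamma\tau_\gamma)$. -/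

import Mathlib

universe u v w

/-! ## Locally convex spaces: approximation property and `ε`-product -/

section LocallyConvex

open scoped ComplexOrder TensorProduct

/-- The convex balanced compact subsets of `E`. -/
def convexBalancedCompacts (𝕜 : Type*) [RCLike 𝕜] (E : Type*) [AddCommGroup E] [Module 𝕜 E]
    [TopologicalSpace E] : Set (Set E) :=
  {K | AbsConvex 𝕜 K ∧ IsCompact K}

/-- `L_c(E; F)`: continuous linear maps with the topology of uniform convergence on the convex
balanced compact subsets of `E`. -/
abbrev CompactConvexCLM (𝕜 : Type*) [RCLike 𝕜] (E F : Type*)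
    [AddCommGroup E] [Module 𝕜 E] [TopologicalSpace E]
    [AddCommGroup F] [Module 𝕜 F] [TopologicalSpace F] :=
  UniformConvergenceCLM (RingHom.id 𝕜) F (convexBalancedCompacts 𝕜 E)

/-- The approximation property (of Schwartz) of a locally convex space `E`: the identity of `E`
lies in the closure of the finite-rank operators in `L_c(E; E)`. -/
def HasAP (𝕜 : Type*) [RCLike 𝕜] (E : Type*) [AddCommGroup E] [Module 𝕜 E]
    [TopologicalSpace E] [IsTopologicalAddGroup E] [ContinuousSMul 𝕜 E] : Prop :=
  ContinuousLinearMap.toUniformConvergenceCLM (RingHom.id 𝕜) E (convexBalancedCompacts 𝕜 E)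
      (ContinuousLinearMap.id 𝕜 E) ∈
    closure {T : CompactConvexCLM 𝕜 E E | FiniteDimensional 𝕜 (LinearMap.range
      ((ContinuousLinearMap.toUniformConvergenceCLM (RingHom.id 𝕜) E
        (convexBalancedCompacts 𝕜 E)).symm T).toLinearMap)}

/-- `F'_c`: the dual of `F` with the topology of uniform convergence on the convex balanced
compact subsets of `F`. -/
abbrev DualC (𝕜 : Type*) [RCLike 𝕜] (F : Type*)
    [AddCommGroup F] [Module 𝕜 F] [TopologicalSpace F] :=
  CompactConvexCLM 𝕜 F 𝕜

/-- The `ε`-product `E ε F = L_ε(F'_c; E)`: continuous linear maps from `F'_c` to `E` with the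
topology of uniform convergence on the equicontinuous subsets of `F'`. -/
abbrev EpsProd (𝕜 : Type*) [RCLike 𝕜] (E F : Type*)
    [AddCommGroup E] [Module 𝕜 E] [TopologicalSpace E]
    [AddCommGroup F] [Module 𝕜 F] [TopologicalSpace F] :=
  UniformConvergenceCLM (RingHom.id 𝕜) E
    {S : Set (DualC 𝕜 F) | Equicontinuous (fun (φ : S) (y : F) => (φ : DualC 𝕜 F) y)}

theorem sUnion_convexBalancedCompacts (𝕜 : Type*) [RCLike 𝕜] (F : Type*) [AddCommGroup F]
    [Module 𝕜 F] [TopologicalSpace F] [ContinuousSMul 𝕜 F] :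
    ⋃₀ convexBalancedCompacts 𝕜 F = Set.univ := by
  refine Set.eq_univ_of_forall fun y => ?_
  refine ⟨(fun c : 𝕜 => c • y) '' Metric.closedBall 0 1, ⟨⟨?_, ?_⟩, ?_⟩, 1, by simp, by simp⟩
  · rintro a ha _ ⟨_, ⟨c, hc, rfl⟩, rfl⟩
    refine ⟨a * c, ?_, by simp [mul_smul]⟩
    simp only [mem_closedBall_zero_iff, norm_mul] at hc ⊢
    exact mul_le_one₀ ha (norm_nonneg _) hc
  · rintro _ ⟨c, hc, rfl⟩ _ ⟨d, hd, rfl⟩ a b ha hb hab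
    refine ⟨a * c + b * d, ?_, by simp [add_smul, mul_smul]⟩
    simp only [mem_closedBall_zero_iff] at hc hd ⊢
    have hn : ‖a‖ + ‖b‖ = 1 := by
      have h1 : ((‖a‖ + ‖b‖ : ℝ) : 𝕜) = 1 := by
        rw [RCLike.ofReal_add, RCLike.norm_of_nonneg' ha, RCLike.norm_of_nonneg' hb, hab]
      exact_mod_cast h1
    calc ‖a * c + b * d‖ ≤ ‖a‖ * ‖c‖ + ‖b‖ * ‖d‖ := by
          simpa only [norm_mul] using norm_add_le (a * c) (b * d)
      _ ≤ ‖a‖ * 1 + ‖b‖ * 1 := by gcongr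
      _ = 1 := by simpa using hn
  · exact (isCompact_closedBall (0 : 𝕜) 1).image (by fun_prop)

/-- The elementary tensor `e ⊗ y` as the operator `φ ↦ φ(y) e` in `E ε F`. -/
def epsElem (𝕜 : Type*) [RCLike 𝕜] {E F : Type*}
    [AddCommGroup E] [Module 𝕜 E] [TopologicalSpace E] [ContinuousSMul 𝕜 E]
    [AddCommGroup F] [Module 𝕜 F] [TopologicalSpace F] [ContinuousSMul 𝕜 F]
    (e : E) (y : F) : DualC 𝕜 F →L[𝕜] E where
  toFun φ := φ y • e
  map_add' φ ψ := by
    change (φ y + ψ y) • e = _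
    rw [add_smul]
  map_smul' c φ := by
    change (c • φ y) • e = _
    rw [smul_assoc]; rfl
  cont := by
    have := UniformConvergenceCLM.continuousEvalConst (RingHom.id 𝕜) 𝕜
      (convexBalancedCompacts 𝕜 F) (sUnion_convexBalancedCompacts 𝕜 F)
    exact (ContinuousEvalConst.continuous_eval_const (F := DualC 𝕜 F) y).smul continuous_const

/-- The canonical linear map `E ⊗ F → E ε F`, sending `e ⊗ y` to `φ ↦ φ(y) e`. -/
noncomputable def tensorToEps (𝕜 : Type*) [RCLike 𝕜] (E F : Type*)
    [AddCommGroup E] [Module 𝕜 E] [TopologicalSpace E] [IsTopologicalAddGroup E]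
    [ContinuousSMul 𝕜 E]
    [AddCommGroup F] [Module 𝕜 F] [TopologicalSpace F] [ContinuousSMul 𝕜 F] :
    E ⊗[𝕜] F →ₗ[𝕜] EpsProd 𝕜 E F :=
  TensorProduct.lift (LinearMap.mk₂ 𝕜 (fun e y =>
      (ContinuousLinearMap.toUniformConvergenceCLM (RingHom.id 𝕜) E _ (epsElem 𝕜 e y) :
        EpsProd 𝕜 E F))
    (fun e e' y => ContinuousLinearMap.ext fun φ => smul_add (φ y) e e')
    (fun c e y => ContinuousLinearMap.ext fun φ => smul_comm (φ y) c e)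
    (fun e y y' => ContinuousLinearMap.ext fun φ => by
      change φ (y + y') • e = φ y • e + φ y' • e
      rw [map_add, add_smul])
    (fun c e y => ContinuousLinearMap.ext fun φ => by
      change φ (c • y) • e = c • (φ y • e)
      rw [map_smul, smul_assoc]))

end LocallyConvex

/-! ## The mixed topology -/

section Mixed

open scoped ComplexOrder

/-- `U` is a sequence of convex balanced `τ`-neighbourhoods of zero. -/
def IsNhdSeq (𝕜 : Type*) [RCLike 𝕜] {E : Type*} [AddCommGroup E] [Module 𝕜 E]
    (τ : TopologicalSpace E) (U : ℕ → Set E) : Prop :=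
  ∀ k, AbsConvex 𝕜 (U k) ∧ U k ∈ @nhds E τ 0

/-- `γ(U) = ⋃ₙ (U₀ ∩ B + U₁ ∩ 2B + ⋯ + Uₙ ∩ 2ⁿB)`, where `B` is the closed unit ball of `p`. -/
def mixedNhd {𝕜 : Type*} [RCLike 𝕜] {E : Type*} [AddCommGroup E] [Module 𝕜 E]
    (p : Seminorm 𝕜 E) (U : ℕ → Set E) : Set E :=
  {x | ∃ n : ℕ, ∃ a : ℕ → E, (∀ k ≤ n, a k ∈ U k ∧ p (a k) ≤ 2 ^ k) ∧
    x = ∑ k ∈ Finset.range (n + 1), a k}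

variable {𝕜 : Type*} [RCLike 𝕜] {E : Type*} [AddCommGroup E] [Module 𝕜 E]

theorem IsNhdSeq.zero_mem {τ : TopologicalSpace E} {U : ℕ → Set E} (hU : IsNhdSeq 𝕜 τ U) (k : ℕ) :
    (0 : E) ∈ U k := mem_of_mem_nhds (hU k).2

theorem mixedNhd_pad {τ : TopologicalSpace E} {p : Seminorm 𝕜 E} {U : ℕ → Set E}
    (hU : IsNhdSeq 𝕜 τ U) {x : E} (hx : x ∈ mixedNhd p U) :
    ∃ n, ∀ m ≥ n, ∃ a : ℕ → E, (∀ k, a k ∈ U k ∧ p (a k) ≤ 2 ^ k) ∧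
      x = ∑ k ∈ Finset.range (m + 1), a k := by
  obtain ⟨n, a, ha, rfl⟩ := hx
  refine ⟨n, fun m hm => ⟨fun k => if k ≤ n then a k else 0, fun k => ?_, ?_⟩⟩
  · by_cases hk : k ≤ n
    · simpa [hk] using ha k hk
    · simpa [hk] using hU.zero_mem k
  · rw [← Finset.sum_subset (Finset.range_mono (Nat.succ_le_succ hm))]
    · refine Finset.sum_congr rfl fun k hk => ?_
      rw [if_pos (Nat.lt_succ_iff.mp (Finset.mem_range.mp hk))]
    · intro k _ hk
      rw [if_neg (fun h => hk (Finset.mem_range.mpr (Nat.lt_succ_of_le h)))]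

theorem mixedNhd_smul_shift {τ : TopologicalSpace E} {p : Seminorm 𝕜 E} {U : ℕ → Set E}
    (hU : IsNhdSeq 𝕜 τ U) (c : 𝕜) (s : ℕ) (hs : ‖c‖ ≤ 2 ^ s) {x : E}
    (hx : x ∈ mixedNhd p fun k => (fun y => c • y) ⁻¹' U (k + s)) : c • x ∈ mixedNhd p U := by
  obtain ⟨n, a, ha, rfl⟩ := hx
  refine ⟨s + n, fun j => if j < s then 0 else c • a (j - s), fun j hj => ?_, ?_⟩
  · by_cases h : j < s
    · simpa [h] using hU.zero_mem j
    · obtain ⟨i, rfl⟩ := Nat.exists_eq_add_of_le (not_lt.mp h)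
      obtain ⟨h1, h2⟩ := ha i (by omega)
      simp only [h, if_false, Nat.add_sub_cancel_left, map_smul_eq_mul]
      refine ⟨by simpa [add_comm] using h1, ?_⟩
      rw [pow_add]
      gcongr
  · rw [add_assoc, Finset.sum_range_add _ s (n + 1), Finset.sum_eq_zero (s := Finset.range s), zero_add,
      Finset.smul_sum]
    · refine Finset.sum_congr rfl fun i _ => by simp
    · intro i hi
      simp [Finset.mem_range.mp hi]

theorem IsNhdSeq.smul_preimage {τ : TopologicalSpace E} (hτ : @ContinuousSMul 𝕜 E _ _ τ)
    {U : ℕ → Set E} (hU : IsNhdSeq 𝕜 τ U) (c : 𝕜) (s : ℕ) :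
    IsNhdSeq 𝕜 τ fun k => (fun y => c • y) ⁻¹' U (k + s) := by
  let := τ
  intro k
  refine ⟨⟨?_, ?_⟩, ?_⟩
  · rintro a ha _ ⟨y, hy, rfl⟩
    have := (hU (k + s)).1.1.smul_mem ha hy
    simpa [smul_comm c a y] using this
  · intro x hx y hy a b ha hb hab
    have := (hU (k + s)).1.2 hx hy ha hb hab
    simpa [smul_comm c a x, smul_comm c b y] using this
  · have hc : Continuous fun y : E => c • y := continuous_const_smul c
    exact hc.continuousAt.preimage_mem_nhds (by simpa using (hU (k + s)).2)

/-- The base of neighbourhoods of zero `{γ(U)}` of the mixed topology `γ[p, τ]`. -/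
def mixedBasis (p : Seminorm 𝕜 E) (τ : TopologicalSpace E) (hτ : @ContinuousSMul 𝕜 E _ _ τ) :
    ModuleFilterBasis 𝕜 E where
  sets := {W | ∃ U : ℕ → Set E, IsNhdSeq 𝕜 τ U ∧ W = mixedNhd p U}
  nonempty := ⟨_, fun _ => Set.univ, fun _ => ⟨AbsConvex.univ, Filter.univ_mem⟩, rfl⟩
  inter_sets := by
    rintro _ _ ⟨U, hU, rfl⟩ ⟨V, hV, rfl⟩
    refine ⟨_, ⟨fun k => U k ∩ V k, fun k => ⟨(hU k).1.inter (hV k).1,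
      Filter.inter_mem (hU k).2 (hV k).2⟩, rfl⟩, ?_⟩
    rintro x ⟨n, a, ha, rfl⟩
    exact ⟨⟨n, a, fun k hk => ⟨(ha k hk).1.1, (ha k hk).2⟩, rfl⟩,
      ⟨n, a, fun k hk => ⟨(ha k hk).1.2, (ha k hk).2⟩, rfl⟩⟩
  zero' := by
    rintro _ ⟨U, hU, rfl⟩
    exact ⟨0, fun _ => 0, fun k _ => ⟨hU.zero_mem k, by simp⟩, by simp⟩
  add' := by
    rintro _ ⟨U, hU, rfl⟩
    have hV := hU.smul_preimage hτ 2 1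
    refine ⟨_, ⟨_, hV, rfl⟩, ?_⟩
    rintro _ ⟨x, hx, y, hy, rfl⟩
    obtain ⟨n, hn⟩ := mixedNhd_pad hV hx
    obtain ⟨m, hm⟩ := mixedNhd_pad hV hy
    obtain ⟨a, ha, hxa⟩ := hn (max n m) (le_max_left _ _)
    obtain ⟨b, hb, hyb⟩ := hm (max n m) (le_max_right _ _)
    have hsum : x + y = ∑ k ∈ Finset.range (max n m + 1), (a k + b k) := by
      rw [hxa, hyb, Finset.sum_add_distrib]
    refine ⟨max n m + 1, fun j => if j = 0 then 0 else a (j - 1) + b (j - 1), fun j _ => ?_, ?_⟩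
    · rcases j with _ | j
      · simpa using hU.zero_mem 0
      · have h2 : (0 : 𝕜) ≤ 2⁻¹ := by
          rw [show (2⁻¹ : 𝕜) = ((2⁻¹ : ℝ) : 𝕜) by rw [RCLike.ofReal_inv, RCLike.ofReal_ofNat]]
          exact RCLike.ofReal_nonneg.mpr (by norm_num)
        have hmem := (hU (j + 1)).1.2 (ha j).1 (hb j).1 h2 h2 (by norm_num)
        have hz : (2 : 𝕜) ≠ 0 := two_ne_zero
        simp only [smul_smul, inv_mul_cancel₀ hz, one_smul] at hmem
        refine ⟨by simpa using hmem, ?_⟩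
        have h3 := map_add_le_add p (a j) (b j)
        have h4 := (ha j).2
        have h5 := (hb j).2
        simp only [Nat.add_one_ne_zero, if_false, Nat.add_sub_cancel, pow_succ]
        linarith
    · change x + y = _
      rw [hsum, Finset.sum_range_succ' _ (max n m + 1)]
      simp
  neg' := by
    rintro _ ⟨U, hU, rfl⟩
    refine ⟨_, ⟨U, hU, rfl⟩, ?_⟩
    rintro _ ⟨n, a, ha, rfl⟩
    refine ⟨n, fun k => -a k, fun k hk => ⟨?_, ?_⟩, by simp⟩
    · exact (hU k).1.1.neg_mem_iff.mpr (ha k hk).1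
    · simpa using (ha k hk).2
  conj' := by
    rintro x₀ _ ⟨U, hU, rfl⟩
    refine ⟨_, ⟨U, hU, rfl⟩, fun x hx => ?_⟩
    simpa using hx
  smul' := by
    rintro _ ⟨U, hU, rfl⟩
    refine ⟨Metric.closedBall 0 1, Metric.closedBall_mem_nhds _ one_pos, _, ⟨U, hU, rfl⟩, ?_⟩
    rintro _ ⟨c, hc, _, ⟨n, a, ha, rfl⟩, rfl⟩
    have hc' : ‖c‖ ≤ 1 := by simpa using hc
    refine ⟨n, fun k => c • a k, fun k hk => ⟨(hU k).1.1.smul_mem hc' (ha k hk).1, ?_⟩,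
      by simp [Finset.smul_sum]⟩
    rw [map_smul_eq_mul]
    exact (mul_le_of_le_one_left (apply_nonneg p _) hc').trans (ha k hk).2
  smul_left' := by
    rintro c _ ⟨U, hU, rfl⟩
    obtain ⟨s, hs⟩ := pow_unbounded_of_one_lt ‖c‖ (one_lt_two (α := ℝ))
    exact ⟨_, ⟨_, hU.smul_preimage hτ c s, rfl⟩,
      fun x hx => mixedNhd_smul_shift hU c s hs.le hx⟩
  smul_right' := by
    rintro m _ ⟨U, hU, rfl⟩
    let := τ
    have h1 : Filter.Tendsto (fun c : 𝕜 => c • m) (nhds 0) (nhds 0) := by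
      have : Continuous fun c : 𝕜 => c • m := by fun_prop
      simpa using this.tendsto 0
    have h2 : Filter.Tendsto (fun c : 𝕜 => ‖c‖ * p m) (nhds 0) (nhds 0) := by
      have : Continuous fun c : 𝕜 => ‖c‖ * p m := by fun_prop
      simpa using this.tendsto 0
    filter_upwards [h1 (hU 0).2, h2.eventually (eventually_le_nhds one_pos)] with c hc hc'
    refine ⟨0, fun _ => c • m, fun k hk => ?_, by simp⟩
    obtain rfl : k = 0 := by omega
    exact ⟨hc, by simpa [map_smul_eq_mul] using hc'⟩

end Mixed

/-! ## Spaces of Lipschitz maps -/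

/-- The maps `X → F` that are Lipschitz and vanish at the base point `x₀`, as a subspace. -/
def lip0Submodule (𝕜 : Type*) [RCLike 𝕜] {X : Type*} [MetricSpace X] (x₀ : X)
    (F : Type*) [NormedAddCommGroup F] [NormedSpace 𝕜 F] : Submodule 𝕜 (X → F) where
  carrier := {f | f x₀ = 0 ∧ ∃ C : NNReal, LipschitzWith C f}
  zero_mem' := ⟨rfl, 0, LipschitzWith.const 0⟩
  add_mem' := by
    rintro f g ⟨hf, C, hC⟩ ⟨hg, D, hD⟩
    exact ⟨by simp [hf, hg], C + D, hC.add hD⟩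
  smul_mem' := by
    rintro c f ⟨hf, C, hC⟩
    refine ⟨by simp [hf], ‖c‖₊ * C, LipschitzWith.of_dist_le_mul fun x y => ?_⟩
    have := hC.dist_le_mul x y
    simp only [Pi.smul_apply, dist_eq_norm, ← smul_sub, norm_smul, NNReal.coe_mul, coe_nnnorm,
      mul_assoc] at this ⊢
    gcongr

/-- `Lip₀(X, F)`: the space of Lipschitz maps from the pointed metric space `(X, x₀)` to `F` that
vanish at `x₀`; it carries the Lipschitz norm below. -/
def Lip0 (𝕜 : Type*) [RCLike 𝕜] {X : Type*} [MetricSpace X] (x₀ : X)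
    (F : Type*) [NormedAddCommGroup F] [NormedSpace 𝕜 F] : Type _ :=
  lip0Submodule 𝕜 x₀ F

namespace Lip0

variable {𝕜 : Type*} [RCLike 𝕜] {X : Type*} [MetricSpace X] {x₀ : X}
  {F : Type*} [NormedAddCommGroup F] [NormedSpace 𝕜 F]

instance : AddCommGroup (Lip0 𝕜 x₀ F) := inferInstanceAs (AddCommGroup (lip0Submodule 𝕜 x₀ F))

instance : Module 𝕜 (Lip0 𝕜 x₀ F) := inferInstanceAs (Module 𝕜 (lip0Submodule 𝕜 x₀ F))

instance : FunLike (Lip0 𝕜 x₀ F) X F where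
  coe f := f.1
  coe_injective _ _ h := Subtype.ext h

@[simp] theorem add_apply (f g : Lip0 𝕜 x₀ F) (x : X) : (f + g) x = f x + g x := rfl

@[simp] theorem smul_apply (c : 𝕜) (f : Lip0 𝕜 x₀ F) (x : X) : (c • f) x = c • f x := rfl

@[simp] theorem zero_apply (x : X) : (0 : Lip0 𝕜 x₀ F) x = 0 := rfl

theorem map_base (f : Lip0 𝕜 x₀ F) : f x₀ = 0 := f.2.1

theorem exists_lipschitzWith (f : Lip0 𝕜 x₀ F) : ∃ C : NNReal, LipschitzWith C f := f.2.2

/-- The quotient `‖f x - f y‖ / d(x, y)` for `x ≠ y`. -/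
noncomputable def slope (f : Lip0 𝕜 x₀ F) (z : {z : X × X // z.1 ≠ z.2}) : ℝ :=
  ‖f z.1.1 - f z.1.2‖ / dist z.1.1 z.1.2

/-- The Lipschitz norm `Lip(f) = sup {‖f x - f y‖ / d(x, y) : x ≠ y}`. -/
noncomputable instance : Norm (Lip0 𝕜 x₀ F) := ⟨fun f => ⨆ z, slope f z⟩

theorem norm_def (f : Lip0 𝕜 x₀ F) : ‖f‖ = ⨆ z, slope f z := rfl

theorem slope_nonneg (f : Lip0 𝕜 x₀ F) (z : {z : X × X // z.1 ≠ z.2}) : 0 ≤ slope f z := by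
  unfold slope; positivity

theorem bddAbove_slope (f : Lip0 𝕜 x₀ F) : BddAbove (Set.range (slope f)) := by
  obtain ⟨C, hC⟩ := f.exists_lipschitzWith
  refine ⟨C, ?_⟩
  rintro _ ⟨z, rfl⟩
  have := hC.dist_le_mul z.1.1 z.1.2
  rw [dist_eq_norm] at this
  exact div_le_of_le_mul₀ dist_nonneg C.2 this

theorem slope_le_norm (f : Lip0 𝕜 x₀ F) (z : {z : X × X // z.1 ≠ z.2}) : slope f z ≤ ‖f‖ :=
  le_ciSup (bddAbove_slope f) z

theorem slope_add_le (f g : Lip0 𝕜 x₀ F) (z : {z : X × X // z.1 ≠ z.2}) :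
    slope (f + g) z ≤ slope f z + slope g z := by
  unfold slope
  rw [← add_div]
  gcongr
  rw [add_apply, add_apply, add_sub_add_comm]
  exact norm_add_le _ _

theorem slope_smul (c : 𝕜) (f : Lip0 𝕜 x₀ F) (z : {z : X × X // z.1 ≠ z.2}) :
    slope (c • f) z = ‖c‖ * slope f z := by
  simp only [slope, smul_apply, ← smul_sub, norm_smul, mul_div_assoc]

theorem norm_sub_le (f : Lip0 𝕜 x₀ F) (x y : X) : ‖f x - f y‖ ≤ ‖f‖ * dist x y := by
  by_cases h : x = y
  · simp [h]
  · exact (div_le_iff₀ (dist_pos.mpr h)).mp (slope_le_norm f ⟨(x, y), h⟩)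

theorem norm_apply_le (f : Lip0 𝕜 x₀ F) (x : X) : ‖f x‖ ≤ ‖f‖ * dist x x₀ := by
  simpa [map_base] using norm_sub_le f x x₀

theorem normCore : NormedSpace.Core 𝕜 (Lip0 𝕜 x₀ F) where
  norm_nonneg f := Real.iSup_nonneg (slope_nonneg f)
  norm_smul c f := by
    simp only [norm_def, slope_smul]
    exact (Real.mul_iSup_of_nonneg (norm_nonneg c) _).symm
  norm_triangle f g := Real.iSup_le
    (fun z => (slope_add_le f g z).trans (add_le_add (slope_le_norm f z) (slope_le_norm g z)))
    (add_nonneg (Real.iSup_nonneg (slope_nonneg f)) (Real.iSup_nonneg (slope_nonneg g)))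
  norm_eq_zero_iff f := by
    refine ⟨fun h => DFunLike.ext _ _ fun x => ?_, ?_⟩
    · have := norm_apply_le f x
      rw [h, zero_mul] at this
      simpa using this
    · rintro rfl
      simp [norm_def, slope]

noncomputable instance : NormedAddCommGroup (Lip0 𝕜 x₀ F) := NormedAddCommGroup.ofCore normCore

noncomputable instance : NormedSpace 𝕜 (Lip0 𝕜 x₀ F) := NormedSpace.ofCore normCore

variable (𝕜 x₀ F)

/-- The inclusion of `Lip₀(X, F)` into the space of continuous maps. -/
def toContinuousMapₗ : Lip0 𝕜 x₀ F →ₗ[𝕜] C(X, F) where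
  toFun f := ⟨f, (f.exists_lipschitzWith).choose_spec.continuous⟩
  map_add' _ _ := rfl
  map_smul' _ _ := rfl

/-- The compact-open topology `τ₀` on `Lip₀(X, F)`. -/
@[reducible] def compactOpen : TopologicalSpace (Lip0 𝕜 x₀ F) :=
  TopologicalSpace.induced (toContinuousMapₗ 𝕜 x₀ F) ContinuousMap.compactOpen

theorem continuousSMul_compactOpen :
    @ContinuousSMul 𝕜 (Lip0 𝕜 x₀ F) _ _ (compactOpen 𝕜 x₀ F) :=
  continuousSMul_induced (toContinuousMapₗ 𝕜 x₀ F)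

/-- The index set of the seminorms generating `γτ_γ`: a sequence of positive reals tending to
zero, and a sequence of pairs of distinct points. -/
def SeqIndex (X : Type*) : Type _ :=
  {α : ℕ → ℝ // (∀ n, 0 < α n) ∧ Filter.Tendsto α Filter.atTop (nhds 0)} ×
    (ℕ → {z : X × X // z.1 ≠ z.2})

variable {𝕜 x₀ F}

theorem bddAbove_seq (i : SeqIndex X) (f : Lip0 𝕜 x₀ F) :
    BddAbove (Set.range fun n => i.1.1 n * slope f (i.2 n)) := by
  obtain ⟨C, hC⟩ := i.1.2.2.bddAbove_range
  refine ⟨C * ‖f‖, ?_⟩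
  rintro _ ⟨n, rfl⟩
  exact mul_le_mul (hC ⟨n, rfl⟩) (slope_le_norm f _) (slope_nonneg f _)
    ((i.1.2.1 n).le.trans (hC ⟨n, rfl⟩))

variable (𝕜 x₀ F)

/-- The seminorm `q(f) = supₙ αₙ ‖f xₙ - f yₙ‖ / d(xₙ, yₙ)` on `Lip₀(X, F)`. -/
noncomputable def seqSeminorm (i : SeqIndex X) : Seminorm 𝕜 (Lip0 𝕜 x₀ F) :=
  Seminorm.of (fun f => ⨆ n, i.1.1 n * slope f (i.2 n))
    (fun f g => ciSup_le fun n =>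
      (mul_le_mul_of_nonneg_left (slope_add_le f g _) (i.1.2.1 n).le).trans <| by
        rw [mul_add]
        exact add_le_add (le_ciSup (bddAbove_seq i f) n) (le_ciSup (bddAbove_seq i g) n))
    (fun c f => by
      simp only [slope_smul, mul_left_comm _ ‖c‖]
      exact (Real.mul_iSup_of_nonneg (norm_nonneg c) _).symm)

/-- The topology `γτ_γ` on `Lip₀(X, F)`, generated by the seminorms `seqSeminorm`. -/
@[reducible] noncomputable def gammaTau : TopologicalSpace (Lip0 𝕜 x₀ F) :=
  ⨅ i : SeqIndex X,
    (seqSeminorm 𝕜 x₀ F i).toSeminormedAddCommGroup.toUniformSpace.toTopologicalSpace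

/-- The Lipschitz finite-rank operators: those whose image spans a finite-dimensional space. -/
def finiteRank : Set (Lip0 𝕜 x₀ F) :=
  {f | FiniteDimensional 𝕜 (Submodule.span 𝕜 (Set.range f))}

/-- The evaluation functional `δ_x` on `Lip₀(X)`. -/
noncomputable def delta (x : X) : StrongDual 𝕜 (Lip0 𝕜 x₀ 𝕜) :=
  LinearMap.mkContinuous
    { toFun := fun f => f x
      map_add' := fun _ _ => rfl
      map_smul' := fun _ _ => rfl } (dist x x₀)
    fun f => (norm_apply_le f x).trans_eq (mul_comm _ _)

end Lip0

/-- The Lipschitz-free space `F(X)`: the closed linear span of the evaluation functionals in the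
normed dual of `Lip₀(X)`. -/
noncomputable abbrev LipFree (𝕜 : Type*) [RCLike 𝕜] {X : Type*} [MetricSpace X] (x₀ : X) :
    Submodule 𝕜 (StrongDual 𝕜 (Lip0 𝕜 x₀ 𝕜)) :=
  (Submodule.span 𝕜 (Set.range (Lip0.delta 𝕜 x₀))).topologicalClosure

/-- `(Lip₀(X), τ_γ)`: the space of scalar Lipschitz functions vanishing at `x₀`, with the mixed
topology `τ_γ = γ[Lip, τ₀]` in place of the norm topology. -/
def LipGamma (𝕜 : Type*) [RCLike 𝕜] {X : Type*} [MetricSpace X] (x₀ : X) : Type _ :=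
  Lip0 𝕜 x₀ 𝕜

namespace LipGamma

variable (𝕜 : Type*) [RCLike 𝕜] {X : Type*} [MetricSpace X] (x₀ : X)

instance : AddCommGroup (LipGamma 𝕜 x₀) := inferInstanceAs (AddCommGroup (Lip0 𝕜 x₀ 𝕜))

instance : Module 𝕜 (LipGamma 𝕜 x₀) := inferInstanceAs (Module 𝕜 (Lip0 𝕜 x₀ 𝕜))

/-- The base of neighbourhoods of zero of `τ_γ = γ[Lip, τ₀]`. -/
noncomputable def basis : ModuleFilterBasis 𝕜 (LipGamma 𝕜 x₀) :=
  mixedBasis (E := Lip0 𝕜 x₀ 𝕜) (normSeminorm 𝕜 (Lip0 𝕜 x₀ 𝕜)) (Lip0.compactOpen 𝕜 x₀ 𝕜)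
    (Lip0.continuousSMul_compactOpen 𝕜 x₀ 𝕜)

noncomputable instance : TopologicalSpace (LipGamma 𝕜 x₀) := (basis 𝕜 x₀).topology

instance : IsTopologicalAddGroup (LipGamma 𝕜 x₀) :=
  (basis 𝕜 x₀).toAddGroupFilterBasis.isTopologicalAddGroup

instance : ContinuousSMul 𝕜 (LipGamma 𝕜 x₀) := (basis 𝕜 x₀).continuousSMul

end LipGamma

open Filter Topology Pointwise
open scoped ComplexOrder TensorProduct

/-! ### Approximation property, domination by compact sets, hulls and transposes -/

section General

variable {𝕜 : Type*} [RCLike 𝕜]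

/-! The free space is a predual of `Lip0`, and the proof identifies `τ_γ` with the topology of
uniform convergence on compact subsets of it. Polars of compact sets are `τ_γ`-neighbourhoods, since
a compact set is approximated, ever more finely, by finite sets of combinations of evaluations
(`LipGamma.polar_mem_nhds`). Conversely, norm balls are `τ_γ`-compact by Arzelà–Ascoli
(`LipGamma.isCompact_closedBall`), and a Banach–Dieudonné argument puts inside every
`τ_γ`-neighbourhood the polar of a null sequence of multiples of molecules
(`LipGamma.exists_seqSeminorm_subset`). A separation argument then shows that the `τ_γ`-dual is the
free space (`LipGamma.exists_eq_eval`).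

1 ⇔ 2: continuous operators `S` on the free space and `T` on `LipGamma` are transposes of each
other, and finite rank passes across. As `⟨m, T f - f⟩ = ⟨S m - m, f⟩`, and as `τ_γ`-compact sets
are norm-bounded, approximating one identity on compact sets approximates the other.

2 ⇔ 4: a Lipschitz map `f` into a Banach space extends to an operator `T` on the free space. If a
finite-rank `S` is close to the identity on a compact set, then `T ∘ S` is close to `T` there.
Conversely, approximating the canonical map `x ↦ δ_x` by finite-rank maps and linearizing
approximates the identity.

3 ⇔ 4: the elements of the `ε`-product are the operators `φ ↦ φ ∘ f` with `f` Lipschitz, and tensors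
correspond to finite-rank `f`. Norming functionals match the two topologies. -/

theorem convexBalancedCompacts_nonempty (E : Type*) [AddCommGroup E] [Module 𝕜 E]
    [TopologicalSpace E] : (convexBalancedCompacts 𝕜 E).Nonempty :=
  ⟨∅, .empty, isCompact_empty⟩

theorem directedOn_convexBalancedCompacts (E : Type*) [AddCommGroup E] [Module 𝕜 E]
    [TopologicalSpace E] [IsTopologicalAddGroup E] :
    DirectedOn (· ⊆ ·) (convexBalancedCompacts 𝕜 E) := by
  intro K hK L hL
  rcases K.eq_empty_or_nonempty with rfl | hK0
  · exact ⟨L, hL, Set.empty_subset _, subset_rfl⟩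
  rcases L.eq_empty_or_nonempty with rfl | hL0
  · exact ⟨K, hK, subset_rfl, Set.empty_subset _⟩
  exact ⟨K + L, ⟨⟨hK.1.1.add hL.1.1, hK.1.2.add hL.1.2⟩, hK.2.add hL.2⟩,
    Set.subset_add_left _ (hL.1.1.zero_mem hL0), Set.subset_add_right _ (hK.1.1.zero_mem hK0)⟩

/-- Directedness of the convex balanced compact sets lets a single compact set and a single
neighbourhood test the closure. -/
theorem hasAP_iff {E : Type*} [AddCommGroup E] [Module 𝕜 E] [TopologicalSpace E]
    [IsTopologicalAddGroup E] [ContinuousSMul 𝕜 E] :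
    HasAP 𝕜 E ↔ ∀ K ∈ convexBalancedCompacts 𝕜 E, ∀ V ∈ 𝓝 (0 : E), ∃ T : E →L[𝕜] E,
      FiniteDimensional 𝕜 (LinearMap.range T.toLinearMap) ∧ ∀ x ∈ K, T x - x ∈ V := by
  have hb := UniformConvergenceCLM.hasBasis_nhds_zero (RingHom.id 𝕜) E
    (convexBalancedCompacts 𝕜 E) (convexBalancedCompacts_nonempty E)
    (directedOn_convexBalancedCompacts E)
  rw [HasAP, mem_closure_iff_nhds_zero]
  constructor
  · intro h K hK V hV
    obtain ⟨T, hT, hTV⟩ := h _ (hb.mem_of_mem (i := (K, V)) ⟨hK, hV⟩)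
    exact ⟨T, hT, hTV⟩
  · intro h W hW
    obtain ⟨⟨K, V⟩, ⟨hK, hV⟩, hKV⟩ := hb.mem_iff.mp hW
    obtain ⟨T, hT, hTV⟩ := h K hK V hV
    exact ⟨T, hT, hKV hTV⟩

/-- A linear functional on `D` dominated by a convex balanced compact set `K` of functionals is
evaluation at a point of `K`. -/
theorem exists_mem_of_dominated {D F : Type*} [AddCommGroup D] [Module 𝕜 D]
    [AddCommGroup F] [Module 𝕜 F] [TopologicalSpace F]
    (p : D → F → 𝕜) (hpc : ∀ d, Continuous (p d)) (hpl : ∀ y, IsLinearMap 𝕜 fun d => p d y)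
    (hpr : ∀ d, IsLinearMap 𝕜 (p d))
    {K : Set F} (hK : K ∈ convexBalancedCompacts 𝕜 F) (hK0 : K.Nonempty) (ψ : D →ₗ[𝕜] 𝕜)
    (hψ : ∀ d, (∀ k ∈ K, ‖p d k‖ ≤ 1) → ‖ψ d‖ ≤ 1) : ∃ k ∈ K, ∀ d, p d k = ψ d := by
  -- By compactness of `K`, only finitely many `d` need to be matched at once; for these the problem
  -- lives in a finite-dimensional space, where Hahn–Banach separates.
  have hfin : ∀ s : Finset D, (K ∩ ⋂ d ∈ s, {k | p d k = ψ d}).Nonempty := by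
    intro s
    let Φ : F → s → 𝕜 := fun k d => p d k
    have hΦc : Continuous Φ := continuous_pi fun d => hpc d
    have hC : IsCompact (Φ '' K) := hK.2.image hΦc
    have hΦl : IsLinearMap 𝕜 Φ :=
      ⟨fun x y => funext fun d => (hpr d).map_add x y,
        fun c x => funext fun d => (hpr d).map_smul c x⟩
    have hconv : Convex ℝ (Φ '' K) := by
      have : Convex 𝕜 (Φ '' K) := hK.1.2.is_linear_image hΦl
      exact this.lift ℝ
    by_contra hne
    have hnot : (fun d : s => ψ d) ∉ Φ '' K := by
      rintro ⟨k, hk, hk'⟩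
      refine hne ⟨k, hk, ?_⟩
      simp only [Set.mem_iInter]
      intro d hd
      exact congrFun hk' ⟨d, hd⟩
    obtain ⟨g, u, hg1, hg2⟩ :=
      RCLike.geometric_hahn_banach_closed_point (𝕜 := 𝕜) hconv hC.isClosed hnot
    -- the functional `g` as an element of `D`
    classical
    -- A functional on `𝕜^s` is a combination of coordinates, so the separating functional is
    -- realized by an element of `D`.
    let d₀ : D := ∑ d : s, g (Pi.single d 1) • (d : D)
    have hgv : ∀ v : s → 𝕜, g v = ∑ d : s, v d * g (Pi.single d 1) := by
      intro v
      conv_lhs => rw [← Finset.univ_sum_single v]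
      rw [map_sum]
      refine Finset.sum_congr rfl fun d _ => ?_
      have : (Pi.single d (v d) : s → 𝕜) = v d • Pi.single d 1 := by
        ext j; simp [Pi.single_apply]
      rw [this, map_smul, smul_eq_mul]
    have h1 : ∀ k, p d₀ k = g (Φ k) := by
      intro k
      rw [hgv]
      have := map_sum (IsLinearMap.mk' _ (hpl k)) (fun d : s => g (Pi.single d 1) • (d : D))
        Finset.univ
      simp only [map_smul, IsLinearMap.mk'_apply, smul_eq_mul] at this
      exact this.trans (Finset.sum_congr rfl fun d _ => mul_comm _ _)
    have h2 : ψ d₀ = g (fun d : s => ψ d) := by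
      rw [hgv, map_sum]
      simp only [map_smul, smul_eq_mul]
      exact Finset.sum_congr rfl fun d _ => mul_comm _ _
    -- Separation bounds only real parts; rotating `k` inside the balanced set `K` bounds the
    -- modulus.
    have hbd : ∀ k ∈ K, ‖p d₀ k‖ < u := by
      intro k hk
      obtain ⟨c, hc, hc'⟩ : ∃ c : 𝕜, ‖c‖ ≤ 1 ∧ c * p d₀ k = ‖p d₀ k‖ := by
        rcases eq_or_ne (p d₀ k) 0 with h0 | h0
        · exact ⟨0, by simp, by simp [h0]⟩
        · refine ⟨(‖p d₀ k‖ : 𝕜) / p d₀ k, ?_, div_mul_cancel₀ _ h0⟩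
          rw [norm_div, RCLike.norm_ofReal, abs_norm, div_self (norm_ne_zero_iff.mpr h0)]
      have := hg1 _ ⟨c • k, hK.1.1.smul_mem hc hk, rfl⟩
      rw [← h1, (hpr d₀).map_smul, smul_eq_mul, hc', RCLike.ofReal_re] at this
      exact this
    have hu : 0 < u := (norm_nonneg _).trans_lt (hbd _ hK0.some_mem)
    have hc := hψ ((u⁻¹ : 𝕜) • d₀) fun k hk => by
      rw [(hpl k).map_smul, smul_eq_mul, norm_mul, norm_inv, RCLike.norm_ofReal, abs_of_pos hu]
      exact (inv_mul_le_one₀ hu).mpr (hbd k hk).le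
    rw [map_smul, smul_eq_mul, norm_mul, norm_inv, RCLike.norm_ofReal, abs_of_pos hu,
      inv_mul_le_one₀ hu, h2] at hc
    exact absurd (hg2.trans_le ((RCLike.re_le_norm _).trans hc)) (lt_irrefl _)
  have hne : (K ∩ ⋂ d : D, {k | p d k = ψ d}).Nonempty :=
    hK.2.inter_iInter_nonempty _ (fun d => isClosed_eq (hpc d) continuous_const) hfin
  obtain ⟨k, hk, hk'⟩ := hne
  exact ⟨k, hk, fun d => Set.mem_iInter.mp hk' d⟩

/-- The balanced hull lies in the compact set of unit-ball multiples of `s`, convex hulls preserve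
total boundedness, and completeness does the rest. -/
theorem isCompact_closedAbsConvexHull {F : Type*} [NormedAddCommGroup F] [NormedSpace 𝕜 F]
    [CompleteSpace F] {s : Set F} (hs : IsCompact s) : IsCompact (closedAbsConvexHull 𝕜 s) := by
  let _ : NormedSpace ℝ F := NormedSpace.restrictScalars ℝ 𝕜 F
  have : IsScalarTower ℝ 𝕜 F := RestrictScalars.isScalarTower ℝ 𝕜 F
  have hP : IsCompact (Metric.closedBall (0 : 𝕜) 1 • s) :=
    (isCompact_closedBall 0 1).smul_set hs
  have hC : IsCompact (closure (convexHull ℝ (Metric.closedBall (0 : 𝕜) 1 • s))) :=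
    hP.totallyBounded.convexHull.closure.isCompact_of_isClosed isClosed_closure
  refine hC.of_isClosed_subset isClosed_closedAbsConvexHull ?_
  rw [closedAbsConvexHull_eq_closure_absConvexHull, absConvexHull_eq_convexHull_balancedHull]
  refine closure_mono (convexHull_min (fun x hx => ?_)
    (convex_RCLike_iff_convex_real.mpr (convex_convexHull ℝ _)))
  obtain ⟨r, hr, y, hy, rfl⟩ := mem_balancedHull_iff.mp hx
  exact subset_convexHull _ _ ⟨r, by simpa using hr, y, hy, rfl⟩

/-- If `S` is transposed to a linear map of finite rank with respect to pairings, then `S` has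
finite rank. -/
theorem finiteDimensional_range_of_transpose {A B C D : Type*}
    [AddCommGroup A] [Module 𝕜 A] [AddCommGroup B] [Module 𝕜 B] [AddCommGroup C] [Module 𝕜 C]
    [AddCommGroup D] [Module 𝕜 D] (T : A →ₗ[𝕜] B) (S : C →ₗ[𝕜] D)
    (p : B →ₗ[𝕜] C →ₗ[𝕜] 𝕜) (q : A → D → 𝕜) (hpq : ∀ a c, q a (S c) = p (T a) c)
    (hq : ∀ d, (∀ a, q a d = 0) → d = 0)
    [FiniteDimensional 𝕜 (LinearMap.range T)] : FiniteDimensional 𝕜 (LinearMap.range S) := by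
  -- `S c` depends only on the functional that `c` induces on the range of `T`, so `S` factors
  -- through a finite-dimensional dual.
  let r : C →ₗ[𝕜] (LinearMap.range T →ₗ[𝕜] 𝕜) := (p.domRestrict (LinearMap.range T)).flip
  have hker : LinearMap.ker r ≤ LinearMap.ker S := by
    intro c hc
    refine hq _ fun a => ?_
    have h1 : p (T a) c = 0 := by
      have := congrArg (fun g => g ⟨T a, a, rfl⟩) (LinearMap.mem_ker.mp hc)
      simpa [r] using this
    rw [hpq, h1]
  have : FiniteDimensional 𝕜 (C ⧸ LinearMap.ker r) :=
    Module.Finite.equiv r.quotKerEquivRange.symm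
  have hr : LinearMap.range S = LinearMap.range ((LinearMap.ker r).liftQ S hker) :=
    ((LinearMap.ker r).range_liftQ S hker).symm
  rw [hr]
  infer_instance

end General

/-! ### The dual `F'_c` and density of tensors in the `ε`-product -/

section Eps

variable {𝕜 : Type*} [RCLike 𝕜]

/-- The continuous linear functional underlying an element of `F'_c`. -/
def DualC.toDual {F : Type*} [AddCommGroup F] [Module 𝕜 F] [TopologicalSpace F] :
    DualC 𝕜 F ≃ₗ[𝕜] StrongDual 𝕜 F :=
  (ContinuousLinearMap.toUniformConvergenceCLM (RingHom.id 𝕜) 𝕜 (convexBalancedCompacts 𝕜 F)).symm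

@[simp] theorem DualC.toDual_symm_apply {F : Type*} [AddCommGroup F] [Module 𝕜 F]
    [TopologicalSpace F] (φ : StrongDual 𝕜 F) (y : F) : DualC.toDual.symm φ y = φ y := rfl

theorem DualC.hasBasis_nhds_zero (F : Type*) [AddCommGroup F] [Module 𝕜 F] [TopologicalSpace F]
    [IsTopologicalAddGroup F] : (𝓝 (0 : DualC 𝕜 F)).HasBasis
      (fun Kε : Set F × ℝ => Kε.1 ∈ convexBalancedCompacts 𝕜 F ∧ 0 < Kε.2)
      fun Kε => {φ : DualC 𝕜 F | ∀ y ∈ Kε.1, φ y ∈ Metric.closedBall (0 : 𝕜) Kε.2} :=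
  UniformConvergenceCLM.hasBasis_nhds_zero_of_basis (RingHom.id 𝕜) 𝕜
    (convexBalancedCompacts 𝕜 F) (convexBalancedCompacts_nonempty F)
    (directedOn_convexBalancedCompacts F) Metric.nhds_basis_closedBall

/-- The dual of `F'_c` is `F`. -/
theorem DualC.exists_eq_eval {F : Type*} [AddCommGroup F] [Module 𝕜 F] [TopologicalSpace F]
    [IsTopologicalAddGroup F] (ψ : DualC 𝕜 F →ₗ[𝕜] 𝕜) (hψ : Continuous ψ) :
    ∃ y : F, ∀ φ : DualC 𝕜 F, φ y = ψ φ := by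
  have h1 : {φ : DualC 𝕜 F | ‖ψ φ‖ ≤ 1} ∈ 𝓝 0 := by
    have h2 : ContinuousAt (fun φ => ‖ψ φ‖) 0 := hψ.norm.continuousAt
    exact h2.eventually (eventually_le_nhds (by simp))
  obtain ⟨⟨K, ε⟩, ⟨hK, hε⟩, hKε⟩ := (DualC.hasBasis_nhds_zero F).mem_iff.mp h1
  dsimp only at hK hε hKε
  -- For empty `K` the basic neighbourhood is the whole dual, so `ψ` is bounded and must vanish.
  rcases K.eq_empty_or_nonempty with rfl | hK0
  · refine ⟨0, fun φ => ?_⟩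
    have h0 : ∀ c : 𝕜, ‖c * ψ φ‖ ≤ 1 := fun c => by
      have : c • φ ∈ {φ : DualC 𝕜 F | ‖ψ φ‖ ≤ 1} := hKε (by simp)
      simpa using this
    by_contra hne
    have hne' : ψ φ ≠ 0 := fun h => hne (by rw [h]; exact map_zero (DualC.toDual φ))
    have := h0 (2 / ψ φ)
    rw [div_mul_cancel₀ _ hne'] at this
    norm_num at this
  have hε' : (ε : 𝕜) ≠ 0 := RCLike.ofReal_ne_zero.mpr hε.ne'
  obtain ⟨k, -, hk⟩ := exists_mem_of_dominated (fun (φ : DualC 𝕜 F) (y : F) => φ y)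
    (fun φ => (DualC.toDual φ).continuous) (fun y => ⟨fun _ _ => rfl, fun _ _ => rfl⟩)
    (fun φ => (DualC.toDual φ).toLinearMap.isLinear) hK hK0 ((ε : 𝕜) • ψ) (fun φ hφ => by
      have : (ε : 𝕜) • φ ∈ {φ : DualC 𝕜 F | ‖ψ φ‖ ≤ 1} := hKε fun y hy => by
        change (ε : 𝕜) • φ y ∈ _
        rw [mem_closedBall_zero_iff, norm_smul, RCLike.norm_ofReal, abs_of_pos hε]
        exact mul_le_of_le_one_right hε.le (hφ y hy)
      simpa [norm_smul] using this)
  refine ⟨(ε : 𝕜)⁻¹ • k, fun φ => ?_⟩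
  have h3 := hk φ
  change DualC.toDual φ k = _ at h3
  change DualC.toDual φ _ = _
  rw [map_smul, h3, LinearMap.smul_apply, smul_eq_mul, smul_eq_mul, inv_mul_cancel_left₀ hε']

theorem equicontinuous_dualC_iff {F : Type*} [NormedAddCommGroup F] [NormedSpace 𝕜 F]
    (S : Set (DualC 𝕜 F)) : Equicontinuous (fun (φ : S) (y : F) => (φ : DualC 𝕜 F) y) ↔
      ∃ C : ℝ, ∀ φ ∈ S, ‖DualC.toDual φ‖ ≤ C := by
  have := (NormedSpace.equicontinuous_TFAE (fun φ : S => DualC.toDual (φ : DualC 𝕜 F))).out 1 5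
  refine (this.trans ?_)
  simp

/-- Equicontinuous sets are the norm-bounded ones, so by rescaling the dual unit ball is the only
one to be tested. -/
theorem denseRange_tensorToEps_iff {E F : Type*} [AddCommGroup E] [Module 𝕜 E]
    [TopologicalSpace E] [IsTopologicalAddGroup E] [ContinuousSMul 𝕜 E]
    [NormedAddCommGroup F] [NormedSpace 𝕜 F] :
    DenseRange (tensorToEps 𝕜 E F) ↔ ∀ u : DualC 𝕜 F →L[𝕜] E, ∀ V ∈ 𝓝 (0 : E), ∃ t,
      ∀ φ : DualC 𝕜 F, ‖DualC.toDual φ‖ ≤ 1 → tensorToEps 𝕜 E F t φ - u φ ∈ V := by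
  have hb := UniformConvergenceCLM.hasBasis_nhds_zero (RingHom.id 𝕜) E
    {S : Set (DualC 𝕜 F) | Equicontinuous (fun (φ : S) (y : F) => (φ : DualC 𝕜 F) y)}
    ⟨∅, (equicontinuous_dualC_iff _).mpr ⟨0, by simp⟩⟩ (by
      intro S hS T hT
      obtain ⟨C, hC⟩ := (equicontinuous_dualC_iff _).mp hS
      obtain ⟨D, hD⟩ := (equicontinuous_dualC_iff _).mp hT
      refine ⟨S ∪ T, (equicontinuous_dualC_iff _).mpr ⟨max C D, ?_⟩, Set.subset_union_left,
        Set.subset_union_right⟩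
      rintro φ (hφ | hφ)
      exacts [(hC φ hφ).trans (le_max_left _ _), (hD φ hφ).trans (le_max_right _ _)])
  constructor
  · intro h u V hV
    have hu := h (ContinuousLinearMap.toUniformConvergenceCLM (RingHom.id 𝕜) E _ u)
    rw [mem_closure_iff_nhds_zero] at hu
    obtain ⟨_, ⟨t, rfl⟩, ht⟩ := hu _ (hb.mem_of_mem
      (i := ({φ : DualC 𝕜 F | ‖DualC.toDual φ‖ ≤ 1}, V))
      ⟨(equicontinuous_dualC_iff _).mpr ⟨1, fun φ hφ => hφ⟩, hV⟩)
    exact ⟨t, fun φ hφ => ht φ hφ⟩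
  · intro h u
    rw [mem_closure_iff_nhds_zero]
    intro W hW
    obtain ⟨⟨S, V⟩, ⟨hS, hV⟩, hSV⟩ := hb.mem_iff.mp hW
    obtain ⟨C, hC⟩ := (equicontinuous_dualC_iff _).mp hS
    set c : ℝ := max C 1
    have hc : 0 < c := zero_lt_one.trans_le (le_max_right _ _)
    have hc' : (c : 𝕜) ≠ 0 := RCLike.ofReal_ne_zero.mpr hc.ne'
    have hV' : (fun e : E => (c : 𝕜) • e) ⁻¹' V ∈ 𝓝 (0 : E) :=
      (continuous_const_smul (c : 𝕜)).continuousAt.preimage_mem_nhds (by simpa using hV)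
    obtain ⟨t, ht⟩ := h ((ContinuousLinearMap.toUniformConvergenceCLM (RingHom.id 𝕜) E _).symm u)
      _ hV'
    refine ⟨_, ⟨t, rfl⟩, hSV fun φ hφ => ?_⟩
    have h1 := ht ((c : 𝕜)⁻¹ • φ) (by
      rw [map_smul, norm_smul, norm_inv, RCLike.norm_ofReal, abs_of_pos hc, inv_mul_le_one₀ hc]
      exact (hC φ hφ).trans (le_max_left _ _))
    have h2 : tensorToEps 𝕜 E F t ((c : 𝕜)⁻¹ • φ) = (c : 𝕜)⁻¹ • tensorToEps 𝕜 E F t φ :=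
      map_smul _ _ _
    have h3 : u ((c : 𝕜)⁻¹ • φ) = (c : 𝕜)⁻¹ • u φ := map_smul _ _ _
    rw [Set.mem_preimage, h2] at h1
    change (c : 𝕜) • (_ - u _) ∈ V at h1
    rw [h3, ← smul_sub, smul_inv_smul₀ hc'] at h1
    exact h1

end Eps

/-! ### Lipschitz maps: composition, the seminorms of `γτ_γ`, compactness of balls -/

namespace Lip0

variable {𝕜 : Type*} [RCLike 𝕜] {X : Type*} [MetricSpace X] {x₀ : X}
  {F : Type*} [NormedAddCommGroup F] [NormedSpace 𝕜 F]
  {G : Type*} [NormedAddCommGroup G] [NormedSpace 𝕜 G]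

theorem norm_le_of_slope_le {f : Lip0 𝕜 x₀ F} {C : ℝ} (hC : 0 ≤ C) (h : ∀ z, slope f z ≤ C) :
    ‖f‖ ≤ C := Real.iSup_le h hC

theorem seqSeminorm_le_iff (i : SeqIndex X) (f : Lip0 𝕜 x₀ F) (C : ℝ) :
    seqSeminorm 𝕜 x₀ F i f ≤ C ↔ ∀ n, i.1.1 n * slope f (i.2 n) ≤ C :=
  ciSup_le_iff (bddAbove_seq i f)

theorem le_seqSeminorm (i : SeqIndex X) (f : Lip0 𝕜 x₀ F) (n : ℕ) :
    i.1.1 n * slope f (i.2 n) ≤ seqSeminorm 𝕜 x₀ F i f :=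
  (seqSeminorm_le_iff i f _).mp le_rfl n

/-- A map that vanishes at the base point and satisfies a Lipschitz estimate. -/
def mk' (f : X → F) (h0 : f x₀ = 0) (C : ℝ) (h : ∀ x y, ‖f x - f y‖ ≤ C * dist x y) :
    Lip0 𝕜 x₀ F :=
  ⟨f, h0, C.toNNReal, LipschitzWith.of_dist_le_mul fun x y => by
    rw [dist_eq_norm]
    exact (h x y).trans (mul_le_mul_of_nonneg_right (Real.le_coe_toNNReal C) dist_nonneg)⟩

theorem slope_le_of_forall {f : Lip0 𝕜 x₀ F} {C : ℝ} (hC : ∀ x y, ‖f x - f y‖ ≤ C * dist x y)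
    (z : {z : X × X // z.1 ≠ z.2}) : slope f z ≤ C :=
  (div_le_iff₀ (dist_pos.mpr z.2)).mpr (hC _ _)

/-- Composition of a Lipschitz map with a continuous linear map. -/
noncomputable def comp (A : F →L[𝕜] G) : Lip0 𝕜 x₀ F →ₗ[𝕜] Lip0 𝕜 x₀ G where
  toFun f := mk' (fun x => A (f x)) (by simp [map_base]) (‖A‖ * ‖f‖) fun x y => by
    rw [← map_sub, mul_assoc]
    exact (A.le_opNorm _).trans (mul_le_mul_of_nonneg_left (norm_sub_le f x y) (norm_nonneg _))
  map_add' f g := DFunLike.ext _ _ fun x => map_add A (f x) (g x)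
  map_smul' c f := DFunLike.ext _ _ fun x => map_smul A c (f x)

@[simp] theorem comp_apply (A : F →L[𝕜] G) (f : Lip0 𝕜 x₀ F) (x : X) : comp A f x = A (f x) := rfl

theorem slope_comp_le (A : F →L[𝕜] G) (f : Lip0 𝕜 x₀ F) (z : {z : X × X // z.1 ≠ z.2}) :
    slope (comp A f) z ≤ ‖A‖ * slope f z := by
  unfold slope
  rw [← mul_div_assoc]
  gcongr
  rw [comp_apply, comp_apply, ← map_sub]
  exact A.le_opNorm _

theorem norm_comp_le (A : F →L[𝕜] G) (f : Lip0 𝕜 x₀ F) : ‖comp A f‖ ≤ ‖A‖ * ‖f‖ :=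
  norm_le_of_slope_le (by positivity) fun z =>
    (slope_comp_le A f z).trans (mul_le_mul_of_nonneg_left (slope_le_norm f z) (norm_nonneg _))

/-- A norming functional for the difference of the two values reduces vector-valued slopes to scalar
ones. -/
theorem slope_le_of_comp {f : Lip0 𝕜 x₀ F} {z : {z : X × X // z.1 ≠ z.2}} {C : ℝ}
    (h : ∀ φ : StrongDual 𝕜 F, ‖φ‖ ≤ 1 → slope (comp φ f) z ≤ C) : slope f z ≤ C := by
  have hz := dist_pos.mpr z.2
  rw [slope, div_le_iff₀ hz]
  obtain ⟨φ, hφ, hφ'⟩ := exists_dual_vector'' 𝕜 (f z.1.1 - f z.1.2)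
  have h1 := h φ hφ
  rw [slope, div_le_iff₀ hz, comp_apply, comp_apply, ← map_sub, hφ', RCLike.norm_ofReal,
    abs_norm] at h1
  exact h1

theorem seqSeminorm_comp_le (i : SeqIndex X) (A : F →L[𝕜] G) (f : Lip0 𝕜 x₀ F) :
    seqSeminorm 𝕜 x₀ G i (comp A f) ≤ ‖A‖ * seqSeminorm 𝕜 x₀ F i f := by
  rw [seqSeminorm_le_iff]
  intro n
  calc i.1.1 n * slope (comp A f) (i.2 n) ≤ i.1.1 n * (‖A‖ * slope f (i.2 n)) :=
        mul_le_mul_of_nonneg_left (slope_comp_le A f _) (i.1.2.1 n).le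
    _ = ‖A‖ * (i.1.1 n * slope f (i.2 n)) := by ring
    _ ≤ _ := mul_le_mul_of_nonneg_left (le_seqSeminorm i f n) (norm_nonneg _)

theorem seqSeminorm_le_of_comp {i : SeqIndex X} {f : Lip0 𝕜 x₀ F} {C : ℝ}
    (h : ∀ φ : StrongDual 𝕜 F, ‖φ‖ ≤ 1 → seqSeminorm 𝕜 x₀ 𝕜 i (comp φ f) ≤ C) :
    seqSeminorm 𝕜 x₀ F i f ≤ C := by
  rw [seqSeminorm_le_iff]
  intro n
  have hn := i.1.2.1 n
  rw [← le_div_iff₀' hn]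
  refine slope_le_of_comp fun φ hφ => ?_
  rw [le_div_iff₀' hn]
  exact (le_seqSeminorm i _ n).trans (h φ hφ)

/-- A countable null family of weights on pairs of distinct points is part of a null sequence. -/
theorem exists_seqIndex {Y : Type*} [Nonempty {z : Y × Y // z.1 ≠ z.2}] {ι : Type*}
    [Countable ι] (β : ι → ℝ)   (hβ : ∀ k, 0 < β k) (hβ0 : Tendsto β cofinite (𝓝 0)) (z : ι → {z : Y × Y // z.1 ≠ z.2}) :
    ∃ i : SeqIndex Y, ∀ k, ∃ n, i.1.1 n = β k ∧ i.2 n = z k := by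
  -- Indices outside the image of `e` receive the weights `1 / (n + 1)`, which keep the sequence
  -- positive and null; their pairs are arbitrary.
  obtain ⟨e, he⟩ := exists_injective_nat ι
  have hpos : ∀ n : ℕ, 0 < Function.extend e β (fun n => 1 / ((n : ℝ) + 1)) n := by
    intro n
    by_cases h : ∃ k, e k = n
    · obtain ⟨k, rfl⟩ := h
      rw [he.extend_apply]
      exact hβ k
    · rw [Function.extend_apply' _ _ _ h]
      positivity
  have hlim : Tendsto (Function.extend e β (fun n => 1 / ((n : ℝ) + 1))) atTop (𝓝 0) := by
    rw [← Nat.cofinite_eq_atTop]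
    rw [Metric.tendsto_nhds] at hβ0 ⊢
    intro ε hε
    have h1 := (Metric.tendsto_nhds.mp (tendsto_one_div_add_atTop_nhds_zero_nat (𝕜 := ℝ))) ε hε
    rw [← Nat.cofinite_eq_atTop] at h1
    have h2 := (hβ0 ε hε)
    rw [Filter.eventually_cofinite] at h1 h2 ⊢
    refine ((h2.image e).union h1).subset fun n hn => ?_
    by_cases h : ∃ k, e k = n
    · obtain ⟨k, rfl⟩ := h
      refine Or.inl ⟨k, ?_, rfl⟩
      simpa [he.extend_apply] using hn
    · refine Or.inr ?_
      rwa [Set.mem_ofPred_eq, Function.extend_apply' _ _ _ h] at hn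
  obtain ⟨w, hw⟩ : ∃ w : ℕ → {z : Y × Y // z.1 ≠ z.2}, ∀ k, w (e k) = z k :=
    ⟨Function.extend e z fun _ => Classical.arbitrary _, fun k => he.extend_apply z _ k⟩
  have hα := he.extend_apply β fun n => 1 / ((n : ℝ) + 1)
  generalize Function.extend e β (fun n => 1 / ((n : ℝ) + 1)) = α at hpos hlim hα
  exact ⟨⟨⟨α, hpos, hlim⟩, w⟩, fun k => ⟨e k, hα k, hw k⟩⟩

/-- Any two of the seminorms generating `γτ_γ` are dominated by a third one. -/
theorem exists_seqSeminorm_ge (i j : SeqIndex X) : ∃ k : SeqIndex X, ∀ f : Lip0 𝕜 x₀ F,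
    seqSeminorm 𝕜 x₀ F i f ≤ seqSeminorm 𝕜 x₀ F k f ∧
      seqSeminorm 𝕜 x₀ F j f ≤ seqSeminorm 𝕜 x₀ F k f := by
  have : Nonempty {z : X × X // z.1 ≠ z.2} := ⟨i.2 0⟩
  -- The disjoint union of two null families is again a countable null family.
  obtain ⟨k, hk⟩ := exists_seqIndex (Sum.elim i.1.1 j.1.1)
    (by rintro (n | n); exacts [i.1.2.1 n, j.1.2.1 n])
    (by
      rw [Metric.tendsto_nhds]
      intro ε hε
      have h1 := Nat.cofinite_eq_atTop.le (Metric.tendsto_nhds.mp i.1.2.2 ε hε)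
      have h2 := Nat.cofinite_eq_atTop.le (Metric.tendsto_nhds.mp j.1.2.2 ε hε)
      change ∀ᶠ _ in cofinite, _ at h1
      change ∀ᶠ _ in cofinite, _ at h2
      rw [Filter.eventually_cofinite] at h1 h2 ⊢
      refine ((h1.image Sum.inl).union (h2.image Sum.inr)).subset ?_
      rintro (n | n) hn
      exacts [Or.inl ⟨n, hn, rfl⟩, Or.inr ⟨n, hn, rfl⟩])
    (Sum.elim i.2 j.2)
  refine ⟨k, fun f => ⟨?_, ?_⟩⟩ <;> rw [seqSeminorm_le_iff] <;> intro n
  · obtain ⟨m, h1, h2⟩ := hk (Sum.inl n)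
    have := le_seqSeminorm k f m
    rwa [h1, h2] at this
  · obtain ⟨m, h1, h2⟩ := hk (Sum.inr n)
    have := le_seqSeminorm k f m
    rwa [h1, h2] at this

/-- The seminorms are directed, so balls of single seminorms form neighbourhood bases. A pair of
distinct points is needed for the family of seminorms to be nonempty. -/
theorem dense_gammaTau_iff [Nonempty {z : X × X // z.1 ≠ z.2}] (S : Set (Lip0 𝕜 x₀ F)) :
    @Dense _ (gammaTau 𝕜 x₀ F) S ↔
      ∀ f, ∀ i : SeqIndex X, ∀ ε > 0, ∃ g ∈ S, seqSeminorm 𝕜 x₀ F i (g - f) < ε := by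
  have hne : Nonempty (SeqIndex X) := by
    obtain ⟨z⟩ := ‹Nonempty {z : X × X // z.1 ≠ z.2}›
    exact ⟨⟨⟨_, fun n => by positivity, tendsto_one_div_add_atTop_nhds_zero_nat (𝕜 := ℝ)⟩,
      fun _ => z⟩⟩
  have hb : ∀ (i : SeqIndex X) (f : Lip0 𝕜 x₀ F),
      (@nhds _ (seqSeminorm 𝕜 x₀ F i).toSeminormedAddCommGroup.toUniformSpace.toTopologicalSpace
        f).HasBasis (fun ε : ℝ => 0 < ε) fun ε => {g | seqSeminorm 𝕜 x₀ F i (g - f) < ε} := by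
    intro i f
    let _ := (seqSeminorm 𝕜 x₀ F i).toSeminormedAddCommGroup
    have h1 := Metric.nhds_basis_ball (x := f)
    refine h1.congr (fun _ => Iff.rfl) fun ε _ => ?_
    ext g
    rw [mem_ball_iff_norm]
    rfl
  have hdir : ∀ f : Lip0 𝕜 x₀ F, Directed (· ≥ ·) fun i : SeqIndex X =>
      @nhds _ (seqSeminorm 𝕜 x₀ F i).toSeminormedAddCommGroup.toUniformSpace.toTopologicalSpace
        f := by
    intro f i j
    obtain ⟨k, hk⟩ := exists_seqSeminorm_ge (𝕜 := 𝕜) (x₀ := x₀) (F := F) i j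
    refine ⟨k, (hb i f).ge_iff.mpr fun ε hε => ?_, (hb j f).ge_iff.mpr fun ε hε => ?_⟩
    · exact (hb k f).mem_iff.mpr ⟨ε, hε, fun g hg => (hk _).1.trans_lt hg⟩
    · exact (hb k f).mem_iff.mpr ⟨ε, hε, fun g hg => (hk _).2.trans_lt hg⟩
  have hmem : ∀ (f : Lip0 𝕜 x₀ F) (V : Set (Lip0 𝕜 x₀ F)), V ∈ @nhds _ (gammaTau 𝕜 x₀ F) f ↔
      ∃ i : SeqIndex X, ∃ ε > 0, {g | seqSeminorm 𝕜 x₀ F i (g - f) < ε} ⊆ V := by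
    intro f V
    rw [gammaTau, nhds_iInf, mem_iInf_of_directed (hdir f)]
    exact exists_congr fun i => (hb i f).mem_iff
  let _ := gammaTau 𝕜 x₀ F
  constructor
  · intro h f i ε hε
    obtain ⟨g, hg, hgS⟩ := mem_closure_iff_nhds.mp (h f) _ ((hmem f _).mpr ⟨i, ε, hε, subset_rfl⟩)
    exact ⟨g, hgS, hg⟩
  · intro h f
    refine mem_closure_iff_nhds.mpr fun V hV => ?_
    obtain ⟨i, ε, hε, hV⟩ := (hmem f V).mp hV
    obtain ⟨g, hgS, hg⟩ := h f i ε hε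
    exact ⟨g, hV hg, hgS⟩

/-- A set on which all the seminorms generating `γτ_γ` are bounded is norm-bounded. -/
theorem exists_norm_le_of_seqSeminorm_bounded (K : Set (Lip0 𝕜 x₀ F))
    (hK : ∀ i : SeqIndex X, ∃ C, ∀ f ∈ K, seqSeminorm 𝕜 x₀ F i f ≤ C) :
    ∃ C, 0 ≤ C ∧ ∀ f ∈ K, ‖f‖ ≤ C := by
  by_contra! hcon
  -- The square beats the null weight `1 / (n + 1)`: one seminorm would exceed `n + 1` on `K` for
  -- every `n`.
  have h : ∀ n : ℕ, ∃ f ∈ K, ∃ z, ((n : ℝ) + 1) ^ 2 < slope f z := by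
    intro n
    obtain ⟨f, hf, hn⟩ := hcon (((n : ℝ) + 1) ^ 2) (by positivity)
    refine ⟨f, hf, ?_⟩
    by_contra! hz
    exact absurd (norm_le_of_slope_le (by positivity) hz) hn.not_ge
  choose f hf z hz using h
  obtain ⟨C, hC⟩ := hK ⟨⟨fun n : ℕ => 1 / ((n : ℝ) + 1), fun n => by positivity,
    tendsto_one_div_add_atTop_nhds_zero_nat (𝕜 := ℝ)⟩, z⟩
  obtain ⟨n, hn⟩ := exists_nat_gt C
  have h1 : 1 / ((n : ℝ) + 1) * slope (f n) (z n) ≤ C := (le_seqSeminorm _ (f n) n).trans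
    (hC (f n) (hf n))
  have hpos : (0 : ℝ) < n + 1 := by positivity
  rw [one_div, inv_mul_le_iff₀ hpos] at h1
  have h2 := hz n
  nlinarith

/-- Arzelà–Ascoli: the ball is equicontinuous, and its Lipschitz estimates describe a closed subset
of a product of compact discs. -/
theorem isCompact_closedBall_compactOpen (r : ℝ) (hr : 0 ≤ r) :
    @IsCompact _ (compactOpen 𝕜 x₀ 𝕜) {f : Lip0 𝕜 x₀ 𝕜 | ‖f‖ ≤ r} := by
  let _ := compactOpen 𝕜 x₀ 𝕜
  have hind : IsInducing (toContinuousMapₗ 𝕜 x₀ 𝕜) := ⟨rfl⟩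
  rw [hind.isCompact_iff]
  have himg : ContinuousMap.toFun '' (toContinuousMapₗ 𝕜 x₀ 𝕜 '' {f : Lip0 𝕜 x₀ 𝕜 | ‖f‖ ≤ r}) =
      {g : X → 𝕜 | g x₀ = 0 ∧ ∀ x y, ‖g x - g y‖ ≤ r * dist x y} := by
    ext g
    constructor
    · rintro ⟨_, ⟨f, hf, rfl⟩, rfl⟩
      exact ⟨f.map_base, fun x y => (norm_sub_le f x y).trans
        (mul_le_mul_of_nonneg_right hf dist_nonneg)⟩
    · rintro ⟨h0, hg⟩
      exact ⟨_, ⟨mk' g h0 r hg, norm_le_of_slope_le hr (slope_le_of_forall hg), rfl⟩, rfl⟩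
  refine ArzelaAscoli.isCompact_of_equicontinuous _ ?_ ?_
  · rw [himg]
    refine (isCompact_univ_pi fun x => isCompact_closedBall (0 : 𝕜) (r * dist x x₀)
      ).of_isClosed_subset ?_ ?_
    · simp only [Set.ofPred_and, Set.ofPred_forall]
      refine (isClosed_eq (continuous_apply x₀) continuous_const).inter
        (isClosed_iInter fun x => isClosed_iInter fun y => isClosed_le ?_ continuous_const)
      exact ((continuous_apply x).sub (continuous_apply y)).norm
    · rintro g ⟨h0, hg⟩ x -
      simpa [h0] using hg x x₀
  · refine (LipschitzWith.uniformEquicontinuous _ r.toNNReal ?_).equicontinuous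
    rintro ⟨_, f, hf, rfl⟩
    refine LipschitzWith.of_dist_le_mul fun x y => ?_
    rw [dist_eq_norm, Real.coe_toNNReal r hr]
    exact (norm_sub_le f x y).trans (mul_le_mul_of_nonneg_right hf dist_nonneg)

end Lip0

/-! ### The Lipschitz-free space: molecules and linearization -/

namespace LipFree

variable {𝕜 : Type*} [RCLike 𝕜] {X : Type*} [MetricSpace X] {x₀ : X}
  {F : Type*} [NormedAddCommGroup F] [NormedSpace 𝕜 F]

noncomputable instance : NormedAddCommGroup (LipFree 𝕜 x₀) := Submodule.normedAddCommGroup _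

noncomputable instance : NormedSpace 𝕜 (LipFree 𝕜 x₀) := Submodule.normedSpace _

variable (𝕜 x₀) in
/-- The evaluation functional as a point of the Lipschitz-free space. -/
noncomputable def point (x : X) : LipFree 𝕜 x₀ :=
  ⟨Lip0.delta 𝕜 x₀ x, Submodule.le_topologicalClosure _ (Submodule.subset_span ⟨x, rfl⟩)⟩

/-- A closed subspace containing the evaluation functionals contains the Lipschitz-free space. -/
theorem mem_of_point_mem {S : Submodule 𝕜 (StrongDual 𝕜 (Lip0 𝕜 x₀ 𝕜))}
    (hS : IsClosed (S : Set (StrongDual 𝕜 (Lip0 𝕜 x₀ 𝕜)))) (h : ∀ x, Lip0.delta 𝕜 x₀ x ∈ S)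
    (m : LipFree 𝕜 x₀) : (m : StrongDual 𝕜 (Lip0 𝕜 x₀ 𝕜)) ∈ S :=
  Submodule.topologicalClosure_minimal _
    (Submodule.span_le.mpr (by rintro _ ⟨x, rfl⟩; exact h x)) hS m.2

variable (𝕜 x₀) in
theorem dense_span_point :
    Dense (Submodule.span 𝕜 (Set.range (point 𝕜 x₀)) : Set (LipFree 𝕜 x₀)) := by
  intro m
  rw [Topology.IsInducing.subtypeVal.closure_eq_preimage_closure_image, Set.mem_preimage]
  have hm := m.2
  rw [← SetLike.mem_coe, Submodule.topologicalClosure_coe] at hm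
  refine closure_mono ?_ hm
  rw [← Submodule.coe_subtype, ← Submodule.map_coe, Submodule.map_span, ← Set.range_comp]
  exact subset_rfl

theorem ext_point {A : Type*} [NormedAddCommGroup A] [NormedSpace 𝕜 A]
    {S T : LipFree 𝕜 x₀ →L[𝕜] A} (h : ∀ x, S (point 𝕜 x₀ x) = T (point 𝕜 x₀ x)) : S = T := by
  refine ContinuousLinearMap.ext_on (dense_span_point 𝕜 x₀) ?_
  rintro _ ⟨x, rfl⟩
  exact h x

theorem map_mem_of_point {A : Type*} [NormedAddCommGroup A] [NormedSpace 𝕜 A]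
    (T : LipFree 𝕜 x₀ →L[𝕜] A) {P : Submodule 𝕜 A} (hP : IsClosed (P : Set A))
    (h : ∀ x, T (point 𝕜 x₀ x) ∈ P) (m : LipFree 𝕜 x₀) : T m ∈ P := by
  have hS : IsClosed ((P.comap T.toLinearMap : Submodule 𝕜 (LipFree 𝕜 x₀)) : Set (LipFree 𝕜 x₀)) :=
    hP.preimage T.continuous
  refine hS.closure_subset_iff.mpr ?_ (dense_span_point 𝕜 x₀ m)
  exact Submodule.span_le.mpr (by rintro _ ⟨x, rfl⟩; exact h x)

theorem norm_point_sub_le (x y : X) : ‖point 𝕜 x₀ x - point 𝕜 x₀ y‖ ≤ dist x y :=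
  ContinuousLinearMap.opNorm_le_bound _ dist_nonneg fun f =>
    (Lip0.norm_sub_le f x y).trans_eq (mul_comm _ _)

theorem point_base : point 𝕜 x₀ x₀ = 0 :=
  Subtype.ext (ContinuousLinearMap.ext fun f => f.map_base)

theorem norm_apply_le (m : LipFree 𝕜 x₀) (f : Lip0 𝕜 x₀ 𝕜) :
    ‖(m : StrongDual 𝕜 (Lip0 𝕜 x₀ 𝕜)) f‖ ≤ ‖m‖ * ‖f‖ :=
  (m : StrongDual 𝕜 (Lip0 𝕜 x₀ 𝕜)).le_opNorm f

theorem norm_le_of_forall {m : LipFree 𝕜 x₀} {C : ℝ}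
    (h : ∀ f : Lip0 𝕜 x₀ 𝕜, ‖f‖ ≤ 1 → ‖(m : StrongDual 𝕜 (Lip0 𝕜 x₀ 𝕜)) f‖ ≤ C) : ‖m‖ ≤ C := by
  simpa using! ContinuousLinearMap.opNorm_bound_of_ball_bound one_pos C
    (m : StrongDual 𝕜 (Lip0 𝕜 x₀ 𝕜)) fun f hf => h f (by simpa using hf)

variable (𝕜 x₀) in
/-- The elementary molecule `(δ_x - δ_y) / d(x, y)`. -/
noncomputable def molecule (z : {z : X × X // z.1 ≠ z.2}) : LipFree 𝕜 x₀ :=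
  ((dist z.1.1 z.1.2 : ℝ) : 𝕜)⁻¹ • (point 𝕜 x₀ z.1.1 - point 𝕜 x₀ z.1.2)

theorem molecule_apply (z : {z : X × X // z.1 ≠ z.2}) (f : Lip0 𝕜 x₀ 𝕜) :
    (molecule 𝕜 x₀ z : StrongDual 𝕜 (Lip0 𝕜 x₀ 𝕜)) f =
      ((dist z.1.1 z.1.2 : ℝ) : 𝕜)⁻¹ * (f z.1.1 - f z.1.2) := rfl

theorem norm_molecule_apply (z : {z : X × X // z.1 ≠ z.2}) (f : Lip0 𝕜 x₀ 𝕜) :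
    ‖(molecule 𝕜 x₀ z : StrongDual 𝕜 (Lip0 𝕜 x₀ 𝕜)) f‖ = Lip0.slope f z := by
  rw [molecule_apply, norm_mul, norm_inv, RCLike.norm_ofReal, abs_of_nonneg dist_nonneg,
    Lip0.slope, div_eq_inv_mul]

theorem norm_molecule_le (z : {z : X × X // z.1 ≠ z.2}) : ‖molecule 𝕜 x₀ z‖ ≤ 1 :=
  norm_le_of_forall fun f hf => by
    rw [norm_molecule_apply]
    exact (Lip0.slope_le_norm f z).trans hf

instance : CompleteSpace (LipFree 𝕜 x₀) :=
  (Submodule.isClosed_topologicalClosure _).completeSpace_coe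

/-- The continuous linear extension to the Lipschitz-free space of a Lipschitz map. -/
theorem exists_linearization [CompleteSpace F] (f : Lip0 𝕜 x₀ F) :
    ∃ T : LipFree 𝕜 x₀ →L[𝕜] F, ∀ m (φ : StrongDual 𝕜 F),
      φ (T m) = (m : StrongDual 𝕜 (Lip0 𝕜 x₀ 𝕜)) (Lip0.comp φ f) := by
  let P : StrongDual 𝕜 F →L[𝕜] Lip0 𝕜 x₀ 𝕜 := LinearMap.mkContinuous
    { toFun := fun φ => Lip0.comp φ f
      map_add' := fun _ _ => rfl
      map_smul' := fun _ _ => rfl } ‖f‖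
    fun φ => (Lip0.norm_comp_le φ f).trans_eq (mul_comm _ _)
  -- `Φ` sends `δ_x` to evaluation at `f x`. As `F` is complete, its canonical image in the bidual
  -- is closed, hence contains the image under `Φ` of the whole free space.
  let Φ : StrongDual 𝕜 (Lip0 𝕜 x₀ 𝕜) →L[𝕜] StrongDual 𝕜 (StrongDual 𝕜 F) :=
    (ContinuousLinearMap.compL 𝕜 (StrongDual 𝕜 F) (Lip0 𝕜 x₀ 𝕜) 𝕜).flip P
  let J := NormedSpace.inclusionInDoubleDualLi 𝕜 (E := F)
  have hJ : IsClosed (LinearMap.range J.toLinearMap : Set (StrongDual 𝕜 (StrongDual 𝕜 F))) :=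
    J.isometry.isUniformInducing.isComplete_range.isClosed
  have hmem : ∀ m : LipFree 𝕜 x₀, ∃ y : F, J y = Φ m := fun m =>
    mem_of_point_mem (S := (LinearMap.range J.toLinearMap).comap Φ.toLinearMap)
      (hJ.preimage Φ.continuous) (fun x => ⟨f x, rfl⟩) m
  choose T hT using hmem
  have hφ : ∀ m (φ : StrongDual 𝕜 F),
      φ (T m) = (m : StrongDual 𝕜 (Lip0 𝕜 x₀ 𝕜)) (Lip0.comp φ f) := fun m φ =>
    congrArg (fun ψ : StrongDual 𝕜 (StrongDual 𝕜 F) => ψ φ) (hT m)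
  refine ⟨LinearMap.mkContinuous { toFun := T, map_add' := ?_, map_smul' := ?_ } ‖f‖ ?_, hφ⟩
  · intro m n
    refine J.injective ?_
    rw [hT, map_add, hT, hT]
    exact map_add Φ _ _
  · intro c m
    refine J.injective ?_
    rw [hT, RingHom.id_apply, map_smul, hT]
    exact map_smul Φ _ _
  · intro m
    refine NormedSpace.norm_le_dual_bound 𝕜 _ (by positivity) fun φ => ?_
    change ‖φ (T m)‖ ≤ _
    rw [hφ]
    refine (norm_apply_le m _).trans ?_
    calc ‖m‖ * ‖Lip0.comp φ f‖ ≤ ‖m‖ * (‖φ‖ * ‖f‖) :=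
          by gcongr; exact Lip0.norm_comp_le φ f
      _ = _ := by ring

end LipFree

/-! ### Norm balls are compact for the mixed topology -/

namespace LipGamma

variable {𝕜 : Type*} [RCLike 𝕜] {X : Type*} [MetricSpace X] {x₀ : X}

/-- The identity from `(Lip₀(X), τ_γ)` to the normed space `Lip₀(X)`. -/
def toLip0 : LipGamma 𝕜 x₀ ≃ₗ[𝕜] Lip0 𝕜 x₀ 𝕜 := LinearEquiv.refl 𝕜 (Lip0 𝕜 x₀ 𝕜)

theorem mem_nhds_zero_iff (V : Set (LipGamma 𝕜 x₀)) : V ∈ 𝓝 0 ↔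
    ∃ U, IsNhdSeq 𝕜 (Lip0.compactOpen 𝕜 x₀ 𝕜) U ∧
      toLip0 ⁻¹' mixedNhd (normSeminorm 𝕜 (Lip0 𝕜 x₀ 𝕜)) U ⊆ V := by
  rw [(basis 𝕜 x₀).toAddGroupFilterBasis.nhds_zero_hasBasis.mem_iff]
  constructor
  · rintro ⟨_, ⟨U, hU, rfl⟩, hV⟩
    exact ⟨U, hU, hV⟩
  · rintro ⟨U, hU, hV⟩
    exact ⟨_, ⟨U, hU, rfl⟩, hV⟩

/-- On norm-bounded sets the mixed topology is no finer than the compact-open one, for which the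
ball is compact. -/
theorem isCompact_closedBall (r : ℝ) (hr : 0 ≤ r) :
    IsCompact {f : LipGamma 𝕜 x₀ | ‖toLip0 f‖ ≤ r} := by
  have himg : {f : LipGamma 𝕜 x₀ | ‖toLip0 f‖ ≤ r} =
      (toLip0 (𝕜 := 𝕜) (x₀ := x₀)).symm '' {f | ‖f‖ ≤ r} := by
    ext f
    exact ⟨fun h => ⟨_, h, rfl⟩, by rintro ⟨g, hg, rfl⟩; exact hg⟩
  rw [himg]
  refine @IsCompact.image_of_continuousOn _ _ (Lip0.compactOpen 𝕜 x₀ 𝕜) _ _ _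
    (Lip0.isCompact_closedBall_compactOpen r hr) ?_
  let _ := Lip0.compactOpen 𝕜 x₀ 𝕜
  intro f hf
  have hτ : IsTopologicalAddGroup (Lip0 𝕜 x₀ 𝕜) :=
    topologicalAddGroup_induced (Lip0.toContinuousMapₗ 𝕜 x₀ 𝕜)
  intro V hV
  have h1 : (fun g => toLip0.symm f + g) ⁻¹' V ∈ 𝓝 (0 : LipGamma 𝕜 x₀) :=
    (continuous_const.add continuous_id).continuousAt.preimage_mem_nhds (by simpa using hV)
  obtain ⟨U, hU, hUV⟩ := (mem_nhds_zero_iff _).mp h1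
  -- Differences of elements of the ball have norm at most `2r < 2 ^ s`, so the summand of index `s`
  -- alone places them in `γ(U)`.
  obtain ⟨s, hs⟩ := pow_unbounded_of_one_lt (r + r) (one_lt_two (α := ℝ))
  have h2 : (fun g => g - f) ⁻¹' U s ∈ @nhds _ (Lip0.compactOpen 𝕜 x₀ 𝕜) f :=
    (continuous_id.sub continuous_const).continuousAt.preimage_mem_nhds (by simpa using (hU s).2)
  rw [Filter.mem_map, mem_nhdsWithin_iff_exists_mem_nhds_inter]
  refine ⟨_, h2, ?_⟩
  rintro g ⟨hg, hgr⟩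
  have h3 : toLip0.symm (g - f) ∈ (fun g => toLip0.symm f + g) ⁻¹' V := by
    refine hUV ⟨s, fun k => if k = s then g - f else 0, fun k hk => ?_, ?_⟩
    · by_cases h : k = s
      · subst h
        simp only [if_true]
        refine ⟨hg, ?_⟩
        rw [coe_normSeminorm]
        exact (norm_sub_le g f).trans ((add_le_add hgr hf).trans hs.le)
      · simp only [h, if_false]
        refine ⟨hU.zero_mem k, ?_⟩
        rw [map_zero]; positivity
    · simp
  have h4 : toLip0.symm f + toLip0.symm (g - f) = toLip0.symm g := by
    rw [← map_add, add_sub_cancel]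
  rwa [Set.mem_preimage, h4] at h3

end LipGamma

/-- A bounded sequence with null weights tends to zero, and the closed hull of a convergent sequence
is compact in a Banach space. -/
theorem exists_nullSeq_compact {𝕜 : Type*} [RCLike 𝕜] {F : Type*} [NormedAddCommGroup F]
    [NormedSpace 𝕜 F] [CompleteSpace F] {α : ℕ → ℝ} (hα : Tendsto α atTop (𝓝 0)) (v : ℕ → F)
    {C : ℝ} (hv : ∀ n, ‖v n‖ ≤ C) :
    ∃ K ∈ convexBalancedCompacts 𝕜 F, ∀ n, (α n : 𝕜) • v n ∈ K := by
  have h0 : Tendsto (fun n => (α n : 𝕜) • v n) atTop (𝓝 0) := by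
    rw [tendsto_zero_iff_norm_tendsto_zero]
    have h1 : Tendsto (fun n => |α n| * C) atTop (𝓝 0) := by
      simpa using hα.abs.mul_const C
    refine squeeze_zero (fun _ => norm_nonneg _) (fun n => ?_) h1
    rw [norm_smul, RCLike.norm_ofReal]
    exact mul_le_mul_of_nonneg_left (hv n) (abs_nonneg _)
  exact ⟨closedAbsConvexHull 𝕜 (insert 0 (Set.range fun n => (α n : 𝕜) • v n)),
    ⟨absConvex_convexClosedHull, isCompact_closedAbsConvexHull h0.isCompact_insert_range⟩,
    fun n => subset_closedAbsConvexHull (Or.inr ⟨n, rfl⟩)⟩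

/-! ### The mixed topology as uniform convergence on compact sets, and its dual -/

namespace LipGamma

variable {𝕜 : Type*} [RCLike 𝕜] {X : Type*} [MetricSpace X] {x₀ : X}

theorem continuous_compactOpen_of_mem_span {y : StrongDual 𝕜 (Lip0 𝕜 x₀ 𝕜)}
    (hy : y ∈ Submodule.span 𝕜 (Set.range (Lip0.delta 𝕜 x₀))) :
    @Continuous _ _ (Lip0.compactOpen 𝕜 x₀ 𝕜) _ y := by
  let _ := Lip0.compactOpen 𝕜 x₀ 𝕜
  induction hy using Submodule.span_induction with
  | mem y hy =>
    obtain ⟨x, rfl⟩ := hy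
    exact (continuous_eval_const (F := C(X, 𝕜)) x).comp
      (continuous_induced_dom (f := Lip0.toContinuousMapₗ 𝕜 x₀ 𝕜))
  | zero => exact continuous_const
  | add y z _ _ hy hz => exact hy.add hz
  | smul c y _ hy => exact hy.const_smul c

/-- Polars of compact subsets of the Lipschitz-free space are neighbourhoods of zero in `τ_γ`. -/
theorem polar_mem_nhds {L : Set (LipFree 𝕜 x₀)} (hL : IsCompact L) :
    {f : LipGamma 𝕜 x₀ | ∀ m ∈ L, ‖(m : StrongDual 𝕜 (Lip0 𝕜 x₀ 𝕜)) (toLip0 f)‖ ≤ 1} ∈ 𝓝 0 := by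
  have hnet : ∀ ε > 0, ∃ t : Set (StrongDual 𝕜 (Lip0 𝕜 x₀ 𝕜)), t.Finite ∧
      (∀ y ∈ t, y ∈ Submodule.span 𝕜 (Set.range (Lip0.delta 𝕜 x₀))) ∧
      ∀ m ∈ L, ∃ y ∈ t, ‖(m : StrongDual 𝕜 (Lip0 𝕜 x₀ 𝕜)) - y‖ < ε := by
    intro ε hε
    obtain ⟨t, ht, hLt⟩ := Metric.totallyBounded_iff.mp hL.totallyBounded (ε / 2) (half_pos hε)
    have happ : ∀ m : LipFree 𝕜 x₀, ∃ y ∈ Submodule.span 𝕜 (Set.range (Lip0.delta 𝕜 x₀)),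
        ‖(m : StrongDual 𝕜 (Lip0 𝕜 x₀ 𝕜)) - y‖ < ε / 2 := by
      intro m
      have hm := m.2
      rw [← SetLike.mem_coe, Submodule.topologicalClosure_coe] at hm
      obtain ⟨y, hy, hmy⟩ := Metric.mem_closure_iff.mp hm (ε / 2) (half_pos hε)
      exact ⟨y, hy, by rwa [dist_eq_norm] at hmy⟩
    choose g hg hg' using happ
    refine ⟨g '' t, ht.image g, by rintro _ ⟨m, -, rfl⟩; exact hg m, fun m hm => ?_⟩
    obtain ⟨m', hm', hmm⟩ := Set.mem_iUnion₂.mp (hLt hm)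
    refine ⟨g m', ⟨m', hm', rfl⟩, ?_⟩
    change dist (m : StrongDual 𝕜 (Lip0 𝕜 x₀ 𝕜)) m' < _ at hmm
    rw [dist_eq_norm] at hmm
    calc ‖(m : StrongDual 𝕜 (Lip0 𝕜 x₀ 𝕜)) - g m'‖
        = ‖((m : StrongDual 𝕜 (Lip0 𝕜 x₀ 𝕜)) - m') + (m' - g m')‖ := by rw [sub_add_sub_cancel]
      _ ≤ _ := norm_add_le _ _
      _ < ε / 2 + ε / 2 := add_lt_add hmm (hg' m')
      _ = ε := add_halves ε
  -- On `2 ^ k B` the net at stage `k` errs by at most `2^{-(k+2)}`, and membership in `U k` allows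
  -- as much again. Each summand thus contributes at most `2^{-(k+1)}`, and the total is at most
  -- `1`.
  choose! t ht1 ht2 ht3 using fun k : ℕ => hnet ((1 / 2) ^ (k + 2) / 2 ^ k) (by positivity)
  refine (mem_nhds_zero_iff _).mpr ⟨fun k => {f | ∀ y ∈ t k, ‖y f‖ ≤ (1 / 2) ^ (k + 2)},
    fun k => ⟨⟨?_, ?_⟩, ?_⟩, ?_⟩
  · rintro c hc _ ⟨f, hf, rfl⟩ y hy
    change ‖y (c • f)‖ ≤ _
    rw [map_smul, norm_smul]
    exact (mul_le_of_le_one_left (norm_nonneg _) hc).trans (hf y hy)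
  · intro f hf g hg a b ha hb hab y hy
    have hconv : Convex 𝕜 (Metric.closedBall (0 : 𝕜) ((1 / 2) ^ (k + 2))) :=
      convex_RCLike_iff_convex_real.mpr (convex_closedBall 0 _)
    have := hconv (mem_closedBall_zero_iff.mpr (hf y hy)) (mem_closedBall_zero_iff.mpr (hg y hy))
      ha hb hab
    simpa using this
  · let _ := Lip0.compactOpen 𝕜 x₀ 𝕜
    have hset : {f : Lip0 𝕜 x₀ 𝕜 | ∀ y ∈ t k, ‖y f‖ ≤ (1 / 2) ^ (k + 2)} =
        ⋂ y ∈ t k, {f | ‖y f‖ ≤ (1 / 2) ^ (k + 2)} := by ext; simp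
    dsimp only
    rw [hset]
    refine (Filter.biInter_mem (ht1 k)).mpr fun y hy => ?_
    have hc : ContinuousAt (fun f => ‖y f‖) (0 : Lip0 𝕜 x₀ 𝕜) :=
      (continuous_compactOpen_of_mem_span (ht2 k y hy)).norm.continuousAt
    exact hc.eventually (eventually_le_nhds (by simp))
  · rintro f ⟨n, a, ha, hf⟩ m hm
    rw [hf, map_sum]
    refine (norm_sum_le _ _).trans ?_
    have hk : ∀ k ∈ Finset.range (n + 1),
        ‖(m : StrongDual 𝕜 (Lip0 𝕜 x₀ 𝕜)) (a k)‖ ≤ 1 / 2 * (1 / 2) ^ k := by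
      intro k hk
      obtain ⟨h1, h2⟩ := ha k (Nat.lt_succ_iff.mp (Finset.mem_range.mp hk))
      obtain ⟨y, hy, hmy⟩ := ht3 k m hm
      have h3 : ‖((m : StrongDual 𝕜 (Lip0 𝕜 x₀ 𝕜)) - y) (a k)‖ ≤ (1 / 2) ^ (k + 2) / 2 ^ k * 2 ^ k :=
        (ContinuousLinearMap.le_opNorm _ _).trans
          (mul_le_mul hmy.le h2 (norm_nonneg _) (by positivity))
      rw [div_mul_cancel₀ _ (by positivity)] at h3
      have h4 := h1 y hy
      calc ‖(m : StrongDual 𝕜 (Lip0 𝕜 x₀ 𝕜)) (a k)‖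
          = ‖((m : StrongDual 𝕜 (Lip0 𝕜 x₀ 𝕜)) - y) (a k) + y (a k)‖ := by simp
        _ ≤ _ := norm_add_le _ _
        _ ≤ (1 / 2) ^ (k + 2) + (1 / 2) ^ (k + 2) := add_le_add h3 h4
        _ = _ := by ring
    refine (Finset.sum_le_sum hk).trans ?_
    rw [← Finset.mul_sum]
    have := sum_geometric_two_le (n + 1)
    linarith

theorem _root_.LipFree.norm_smul_molecule_apply {α : ℝ} (hα : 0 < α)
    (z : {z : X × X // z.1 ≠ z.2}) (f : Lip0 𝕜 x₀ 𝕜) :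
    ‖(((α : 𝕜) • LipFree.molecule 𝕜 x₀ z : LipFree 𝕜 x₀) : StrongDual 𝕜 (Lip0 𝕜 x₀ 𝕜)) f‖ =
      α * Lip0.slope f z := by
  rw [Submodule.coe_smul, smul_apply, norm_smul, RCLike.norm_ofReal, abs_of_pos hα,
    LipFree.norm_molecule_apply]

/-- The seminorms generating `γτ_γ` are dominated by suprema over compact subsets of the
Lipschitz-free space. -/
theorem exists_compact_seqSeminorm_le (i : Lip0.SeqIndex X) :
    ∃ L ∈ convexBalancedCompacts 𝕜 (LipFree 𝕜 x₀), L.Nonempty ∧ ∀ (f : Lip0 𝕜 x₀ 𝕜) (c : ℝ),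
      (∀ m ∈ L, ‖(m : StrongDual 𝕜 (Lip0 𝕜 x₀ 𝕜)) f‖ ≤ c) →
        Lip0.seqSeminorm 𝕜 x₀ 𝕜 i f ≤ c := by
  obtain ⟨L, hL, hLn⟩ := exists_nullSeq_compact (𝕜 := 𝕜) i.1.2.2
    (fun n => LipFree.molecule 𝕜 x₀ (i.2 n)) (fun n => LipFree.norm_molecule_le _)
  refine ⟨L, hL, ⟨_, hLn 0⟩, fun f c hf => (Lip0.seqSeminorm_le_iff i _ c).mpr fun n => ?_⟩
  rw [← LipFree.norm_smul_molecule_apply (i.1.2.1 n)]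
  exact hf _ (hLn n)

theorem seqSeminorm_le_mem_nhds (i : Lip0.SeqIndex X) :
    {f : LipGamma 𝕜 x₀ | Lip0.seqSeminorm 𝕜 x₀ 𝕜 i (toLip0 f) ≤ 1} ∈ 𝓝 0 := by
  obtain ⟨L, hL, -, hLi⟩ := exists_compact_seqSeminorm_le (𝕜 := 𝕜) (x₀ := x₀) i
  filter_upwards [polar_mem_nhds hL.2] with f hf
  exact hLi _ 1 hf

theorem continuous_seqSeminorm (i : Lip0.SeqIndex X) :
    Continuous fun f : LipGamma 𝕜 x₀ => Lip0.seqSeminorm 𝕜 x₀ 𝕜 i (toLip0 f) :=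
  Seminorm.continuous' (r := 1)
    (p := (Lip0.seqSeminorm 𝕜 x₀ 𝕜 i).comp (toLip0 (𝕜 := 𝕜) (x₀ := x₀)).toLinearMap) (by
      filter_upwards [seqSeminorm_le_mem_nhds i] with f hf
      rw [Seminorm.mem_closedBall_zero]
      exact hf)

theorem continuous_eval (m : LipFree 𝕜 x₀) :
    Continuous fun f : LipGamma 𝕜 x₀ => (m : StrongDual 𝕜 (Lip0 𝕜 x₀ 𝕜)) (toLip0 f) := by
  let ψ : LipGamma 𝕜 x₀ →ₗ[𝕜] 𝕜 :=
    (m : StrongDual 𝕜 (Lip0 𝕜 x₀ 𝕜)).toLinearMap ∘ₗ toLip0.toLinearMap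
  have h1 : Continuous ((normSeminorm 𝕜 𝕜).comp ψ) := Seminorm.continuous' (r := 1) (by
    filter_upwards [polar_mem_nhds (isCompact_singleton (x := m))] with f hf
    rw [Seminorm.mem_closedBall_zero]
    exact hf m rfl)
  refine continuous_of_continuousAt_zero ψ ?_
  rw [ContinuousAt, map_zero, tendsto_zero_iff_norm_tendsto_zero]
  have h2 := h1.tendsto 0
  rwa [map_zero] at h2

theorem continuous_slope (z : {z : X × X // z.1 ≠ z.2}) :
    Continuous fun f : LipGamma 𝕜 x₀ => Lip0.slope (toLip0 f) z := by
  simp_rw [← LipFree.norm_molecule_apply]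
  exact (continuous_eval _).norm

/-- The unit ball is `τ_γ`-compact, so the tube lemma for scalar multiplication near `{0} × B` shows
that every neighbourhood absorbs it. -/
theorem exists_pos_ball_subset {U : Set (LipGamma 𝕜 x₀)} (hU : U ∈ 𝓝 0) :
    ∃ b > 0, ∀ f, ‖toLip0 f‖ ≤ b → f ∈ U := by
  obtain ⟨O, hOU, hO, h0⟩ := mem_nhds_iff.mp hU
  have hN : IsOpen ((fun q : 𝕜 × LipGamma 𝕜 x₀ => q.1 • q.2) ⁻¹' O) :=
    hO.preimage continuous_smul
  obtain ⟨u, v, hu, -, hu0, hv, huv⟩ := generalized_tube_lemma (isCompact_singleton (x := (0 : 𝕜)))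
    (isCompact_closedBall (𝕜 := 𝕜) (x₀ := x₀) 1 zero_le_one) hN (by
      rintro ⟨c, f⟩ ⟨hc, -⟩
      rw [Set.mem_singleton_iff] at hc
      subst hc
      simpa using h0)
  obtain ⟨r, hr, hru⟩ := Metric.isOpen_iff.mp hu 0 (hu0 rfl)
  refine ⟨r / 2, half_pos hr, fun f hf => hOU ?_⟩
  have hc : (((r / 2 : ℝ)) : 𝕜) ≠ 0 := RCLike.ofReal_ne_zero.mpr (half_pos hr).ne'
  have h1 : (((r / 2 : ℝ) : 𝕜), (((r / 2 : ℝ) : 𝕜)⁻¹ • f)) ∈ u ×ˢ v := by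
    refine ⟨hru ?_, hv ?_⟩
    · rw [mem_ball_zero_iff, RCLike.norm_ofReal, abs_of_pos (half_pos hr)]
      exact half_lt_self hr
    · change ‖toLip0 _‖ ≤ 1
      rw [map_smul, norm_smul, norm_inv, RCLike.norm_ofReal, abs_of_pos (half_pos hr),
        inv_mul_le_one₀ (half_pos hr)]
      exact hf
  have h2 := huv h1
  rwa [Set.mem_preimage, smul_inv_smul₀ hc] at h2

/-- The topology `τ_γ` is coarser than the topology generated by the seminorms `seqSeminorm`. -/
theorem exists_seqSeminorm_subset [Nonempty {z : X × X // z.1 ≠ z.2}] {V : Set (LipGamma 𝕜 x₀)}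
    (hV : V ∈ 𝓝 0) : ∃ i, ∀ f, Lip0.seqSeminorm 𝕜 x₀ 𝕜 i (toLip0 f) ≤ 1 → f ∈ V := by
  obtain ⟨U, hUV, hU, h0⟩ := mem_nhds_iff.mp hV
  obtain ⟨b, hb, hbU⟩ := exists_pos_ball_subset (hU.mem_nhds h0)
  -- Banach–Dieudonné induction. Imposing slope at most `b + n` at all pairs would bring the norm
  -- down to `b + n`, where `A` is already inside `U`. By compactness of the next ball, finitely
  -- many pairs suffice.
  have step : ∀ (n : ℕ) (A : Set (LipGamma 𝕜 x₀)),
      ∃ t : Finset {z : X × X // z.1 ≠ z.2}, IsClosed A →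
        (∀ f ∈ A, ‖toLip0 f‖ ≤ b + n → f ∈ U) →
        ∀ f ∈ A, ‖toLip0 f‖ ≤ b + (n + 1 : ℕ) →
          (∀ z ∈ t, Lip0.slope (toLip0 f) z ≤ b + n) → f ∈ U := by
    intro n A
    by_cases hA : IsClosed A ∧ ∀ f ∈ A, ‖toLip0 f‖ ≤ b + n → f ∈ U
    · obtain ⟨hA, hAU⟩ := hA
      have hC : IsCompact ({f : LipGamma 𝕜 x₀ | ‖toLip0 f‖ ≤ b + (n + 1 : ℕ)} ∩ (A ∩ Uᶜ)) :=
        (isCompact_closedBall _ (by positivity)).inter_right (hA.inter hU.isClosed_compl)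
      obtain ⟨t, ht⟩ := hC.elim_finite_subfamily_closed
        (fun z => {f : LipGamma 𝕜 x₀ | Lip0.slope (toLip0 f) z ≤ b + n})
        (fun z => isClosed_le (continuous_slope z) continuous_const) (by
          rw [Set.eq_empty_iff_forall_notMem]
          rintro f ⟨⟨-, hfA, hfU⟩, hf⟩
          exact hfU (hAU f hfA (Lip0.norm_le_of_slope_le (by positivity) fun z =>
            Set.mem_iInter.mp hf z)))
      refine ⟨t, fun _ _ f hfA hfn hft => ?_⟩
      by_contra hfU
      exact Set.eq_empty_iff_forall_notMem.mp ht f ⟨⟨hfn, hfA, hfU⟩, Set.mem_iInter₂.mpr hft⟩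
    · exact ⟨∅, fun h1 h2 => absurd ⟨h1, h2⟩ hA⟩
  choose t ht using step
  let A : ℕ → Set (LipGamma 𝕜 x₀) := fun n => Nat.rec Set.univ
    (fun n A => A ∩ ⋂ z ∈ t n A, {f | Lip0.slope (toLip0 f) z ≤ b + n}) n
  have hA : ∀ n, IsClosed (A n) ∧ ∀ f ∈ A n, ‖toLip0 f‖ ≤ b + n → f ∈ U := by
    intro n
    induction n with
    | zero => exact ⟨isClosed_univ, fun f _ hf => hbU f (by simpa using hf)⟩
    | succ n ih =>
      refine ⟨ih.1.inter (isClosed_biInter fun z _ =>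
        isClosed_le (continuous_slope z) continuous_const), fun f hf hfn => ?_⟩
      exact ht n (A n) ih.1 ih.2 f hf.1 hfn fun z hz => Set.mem_iInter₂.mp hf.2 z hz
  -- A pair from stage `n` gets weight `1 / (b + n)`, so seminorm at most `1` says exactly that its
  -- slope is at most `b + n`. The weights are null because each stage is finite.
  obtain ⟨i, hi⟩ := Lip0.exists_seqIndex (ι := Σ n, {z // z ∈ t n (A n)})
    (fun k => 1 / (b + k.1)) (fun k => by positivity) (by
      rw [Metric.tendsto_nhds]
      intro ε hε
      rw [Filter.eventually_cofinite]
      obtain ⟨N, hN⟩ := exists_nat_gt (1 / ε)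
      refine (Set.finite_range fun k : Σ n : Fin N, {z // z ∈ t n (A n)} =>
        (⟨k.1, k.2⟩ : Σ n, {z // z ∈ t n (A n)})).subset ?_
      rintro ⟨n, z⟩ hz
      suffices h : n < N from ⟨⟨⟨n, h⟩, z⟩, rfl⟩
      by_contra! hn
      refine hz ?_
      have hn' : (N : ℝ) ≤ n := by exact_mod_cast hn
      rw [Real.dist_0_eq_abs, abs_of_pos (by positivity), one_div_lt (by positivity) hε]
      linarith)
    (fun k => k.2.1)
  refine ⟨i, fun f hf => hUV ?_⟩
  have hmem : ∀ n, f ∈ A n := by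
    intro n
    induction n with
    | zero => exact Set.mem_univ f
    | succ n ih =>
      refine ⟨ih, Set.mem_iInter₂.mpr fun z hz => ?_⟩
      obtain ⟨j, hj1, hj2⟩ := hi ⟨n, z, hz⟩
      have h1 := (Lip0.le_seqSeminorm i (toLip0 f) j).trans hf
      rw [hj1, hj2, one_div, inv_mul_le_one₀ (by positivity)] at h1
      exact h1
  obtain ⟨n, hn⟩ := exists_nat_ge ‖toLip0 f‖
  exact (hA n).2 f (hmem n) (by linarith)

theorem exists_norm_le_of_isCompact {K : Set (LipGamma 𝕜 x₀)} (hK : IsCompact K) :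
    ∃ C, 0 ≤ C ∧ ∀ f ∈ K, ‖toLip0 f‖ ≤ C :=
  Lip0.exists_norm_le_of_seqSeminorm_bounded K fun i => by
    obtain ⟨C, hC⟩ := (hK.image (continuous_seqSeminorm i)).bddAbove
    exact ⟨C, fun f hf => hC ⟨f, hf, rfl⟩⟩

/-- The `τ_γ`-continuous linear functionals are the elements of the Lipschitz-free space. -/
theorem exists_eq_eval [Nonempty {z : X × X // z.1 ≠ z.2}] (ψ : LipGamma 𝕜 x₀ →L[𝕜] 𝕜) :
    ∃ m : LipFree 𝕜 x₀, ∀ f, (m : StrongDual 𝕜 (Lip0 𝕜 x₀ 𝕜)) (toLip0 f) = ψ f := by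
  have h1 : {f | ‖ψ f‖ ≤ 1} ∈ 𝓝 (0 : LipGamma 𝕜 x₀) :=
    ψ.continuous.norm.continuousAt.eventually (eventually_le_nhds (by simp))
  obtain ⟨i, hi⟩ := exists_seqSeminorm_subset h1
  obtain ⟨L, hL, hL0, hLi⟩ := exists_compact_seqSeminorm_le (𝕜 := 𝕜) (x₀ := x₀) i
  -- `ψ` is bounded by `1` on the polar of `L`, so it is evaluation at a point of `L`.
  obtain ⟨m, -, hm⟩ := exists_mem_of_dominated
    (fun (f : LipGamma 𝕜 x₀) (m : LipFree 𝕜 x₀) =>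
      (m : StrongDual 𝕜 (Lip0 𝕜 x₀ 𝕜)) (toLip0 f))
    (fun f => (ContinuousLinearMap.apply 𝕜 𝕜 (toLip0 f)).continuous.comp continuous_subtype_val)
    (fun m => ⟨fun f g => map_add (m : StrongDual 𝕜 (Lip0 𝕜 x₀ 𝕜)) (toLip0 f) (toLip0 g),
      fun c f => map_smul (m : StrongDual 𝕜 (Lip0 𝕜 x₀ 𝕜)) c (toLip0 f)⟩)
    (fun f => ⟨fun _ _ => rfl, fun _ _ => rfl⟩) hL hL0 ψ.toLinearMap
    (fun f hf => hi f (hLi _ 1 hf))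
  exact ⟨m, hm⟩

end LipGamma

/-! ### Transposition between the free space and `(Lip₀(X), τ_γ)` -/

section Main

variable {𝕜 : Type*} [RCLike 𝕜] {X : Type*} [MetricSpace X] {x₀ : X}
  {F : Type*} [NormedAddCommGroup F] [NormedSpace 𝕜 F]

open LipGamma (toLip0)

theorem norm_le_of_forall_dual {y : F} {C : ℝ}
    (h : ∀ φ : StrongDual 𝕜 F, ‖φ‖ ≤ 1 → ‖φ y‖ ≤ C) : ‖y‖ ≤ C := by
  obtain ⟨φ, hφ, hφy⟩ := exists_dual_vector'' 𝕜 y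
  simpa [hφy] using h φ hφ

namespace LipFree

/-- Composition of a bounded operator on the Lipschitz-free space with the map `x ↦ δ_x`. -/
noncomputable def toLip (T : LipFree 𝕜 x₀ →L[𝕜] F) : Lip0 𝕜 x₀ F :=
  Lip0.mk' (fun x => T (point 𝕜 x₀ x)) (by rw [point_base, map_zero]) ‖T‖ fun x y => by
    rw [← map_sub]
    exact (T.le_opNorm _).trans
      (mul_le_mul_of_nonneg_left (norm_point_sub_le x y) (norm_nonneg _))

/-- Both sides are continuous and linear in `m` and agree at every `δ_x`. -/
theorem apply_comp_toLip (T : LipFree 𝕜 x₀ →L[𝕜] F) (φ : StrongDual 𝕜 F) (m : LipFree 𝕜 x₀) :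
    (m : StrongDual 𝕜 (Lip0 𝕜 x₀ 𝕜)) (Lip0.comp φ (toLip T)) = φ (T m) := by
  have : (ContinuousLinearMap.apply 𝕜 𝕜 (Lip0.comp φ (toLip T))) ∘L (LipFree 𝕜 x₀).subtypeL =
      φ ∘L T := ext_point fun x => rfl
  exact congrArg (fun S : LipFree 𝕜 x₀ →L[𝕜] 𝕜 => S m) this

variable (𝕜 x₀) in
/-- The duality between the Lipschitz-free space and `(Lip₀(X), τ_γ)`. -/
noncomputable def pairing : LipFree 𝕜 x₀ →ₗ[𝕜] LipGamma 𝕜 x₀ →ₗ[𝕜] 𝕜 :=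
  LinearMap.mk₂ 𝕜 (fun m f => (m : StrongDual 𝕜 (Lip0 𝕜 x₀ 𝕜)) (toLip0 f))
    (fun _ _ _ => rfl) (fun _ _ _ => rfl)
    (fun m f g => map_add (m : StrongDual 𝕜 (Lip0 𝕜 x₀ 𝕜)) (toLip0 f) (toLip0 g))
    (fun c m f => map_smul (m : StrongDual 𝕜 (Lip0 𝕜 x₀ 𝕜)) c (toLip0 f))

theorem pairing_apply (m : LipFree 𝕜 x₀) (f : LipGamma 𝕜 x₀) :
    pairing 𝕜 x₀ m f = (m : StrongDual 𝕜 (Lip0 𝕜 x₀ 𝕜)) (toLip0 f) := rfl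

theorem ext_pairing {m n : LipFree 𝕜 x₀} (h : ∀ f, pairing 𝕜 x₀ m f = pairing 𝕜 x₀ n f) : m = n :=
  Subtype.ext (ContinuousLinearMap.ext h)

theorem _root_.LipGamma.ext_pairing {f g : LipGamma 𝕜 x₀}
    (h : ∀ m, pairing 𝕜 x₀ m f = pairing 𝕜 x₀ m g) : f = g :=
  toLip0.injective (DFunLike.ext _ _ fun x => h (point 𝕜 x₀ x))

/-- The transpose of a bounded operator on the Lipschitz-free space. -/
theorem exists_transpose [Nonempty {z : X × X // z.1 ≠ z.2}]
    (S : LipFree 𝕜 x₀ →L[𝕜] LipFree 𝕜 x₀) : ∃ T : LipGamma 𝕜 x₀ →L[𝕜] LipGamma 𝕜 x₀,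
      ∀ m f, pairing 𝕜 x₀ m (T f) = pairing 𝕜 x₀ (S m) f := by
  -- The transpose sends `f` to `x ↦ ⟨S δ_x, f⟩`.
  let P : Lip0 𝕜 x₀ 𝕜 → LipFree 𝕜 x₀ →L[𝕜] 𝕜 := fun f =>
    ContinuousLinearMap.apply 𝕜 𝕜 f ∘L (LipFree 𝕜 x₀).subtypeL ∘L S
  have hP : ∀ m f, pairing 𝕜 x₀ m (toLip0.symm (toLip (P (toLip0 f)))) =
      pairing 𝕜 x₀ (S m) f := fun m f =>
    apply_comp_toLip (P (toLip0 f)) (ContinuousLinearMap.id 𝕜 𝕜) m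
  let T : LipGamma 𝕜 x₀ →ₗ[𝕜] LipGamma 𝕜 x₀ :=
    { toFun := fun f => toLip0.symm (toLip (P (toLip0 f)))
      map_add' := fun f g => LipGamma.ext_pairing fun m => by
        rw [hP, map_add, map_add, hP, hP]
      map_smul' := fun c f => LipGamma.ext_pairing fun m => by
        rw [hP, map_smul, map_smul, hP, RingHom.id_apply] }
  refine ⟨⟨T, continuous_of_continuousAt_zero T fun V hV => ?_⟩, hP⟩
  rw [map_zero] at hV
  obtain ⟨i, hi⟩ := LipGamma.exists_seqSeminorm_subset hV
  obtain ⟨L, hL, -, hLi⟩ := LipGamma.exists_compact_seqSeminorm_le (𝕜 := 𝕜) (x₀ := x₀) i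
  refine Filter.mem_map.mpr ?_
  -- The polar of the compact set `S(L)` is mapped into the polar of `L`.
  filter_upwards [LipGamma.polar_mem_nhds (hL.2.image S.continuous)] with f hf
  refine hi _ (hLi _ 1 fun m hm => ?_)
  have h1 := hf _ ⟨m, hm, rfl⟩
  rwa [← pairing_apply, ← hP] at h1

/-- The transpose of a continuous operator on `(Lip₀(X), τ_γ)`. -/
theorem _root_.LipGamma.exists_transpose [Nonempty {z : X × X // z.1 ≠ z.2}]
    (T : LipGamma 𝕜 x₀ →L[𝕜] LipGamma 𝕜 x₀) : ∃ S : LipFree 𝕜 x₀ →L[𝕜] LipFree 𝕜 x₀,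
      ∀ m f, pairing 𝕜 x₀ (S m) f = pairing 𝕜 x₀ m (T f) := by
  have h : ∀ m, ∃ n : LipFree 𝕜 x₀, ∀ f, pairing 𝕜 x₀ n f = pairing 𝕜 x₀ m (T f) := fun m =>
    LipGamma.exists_eq_eval ⟨pairing 𝕜 x₀ m ∘ₗ T.toLinearMap,
      (LipGamma.continuous_eval m).comp T.continuous⟩
  choose S hS using h
  -- The image of the compact unit ball under `T` is norm-bounded; its bound controls `S`.
  obtain ⟨C, hC, hTC⟩ := LipGamma.exists_norm_le_of_isCompact
    ((LipGamma.isCompact_closedBall (𝕜 := 𝕜) (x₀ := x₀) 1 zero_le_one).image T.continuous)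
  refine ⟨LinearMap.mkContinuous
    { toFun := S
      map_add' := fun m n => ext_pairing fun f => by
        rw [hS, map_add, map_add, LinearMap.add_apply, LinearMap.add_apply, hS, hS]
      map_smul' := fun c m => ext_pairing fun f => by
        rw [hS, map_smul, map_smul, LinearMap.smul_apply, LinearMap.smul_apply, hS,
          RingHom.id_apply] } C fun m => ?_, hS⟩
  refine norm_le_of_forall fun f hf => ?_
  have h1 := hS m (toLip0.symm f)
  rw [pairing_apply, pairing_apply, LinearEquiv.apply_symm_apply] at h1
  change ‖(S m : StrongDual 𝕜 (Lip0 𝕜 x₀ 𝕜)) f‖ ≤ _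
  rw [h1, mul_comm]
  refine (norm_apply_le m _).trans ?_
  gcongr
  exact hTC _ ⟨toLip0.symm f, hf, rfl⟩

end LipFree

/-! ### Transfer of the approximation property -/

open LipFree (pairing pairing_apply)

/-- A compact `K` lies in a ball of some radius `C`, and `V` contains the polar of a compact `L`.
Approximating the identity on `L` within `1 / (C + 1)` and transposing gives the operator. -/
theorem hasAP_lipGamma_of_lipFree [Nonempty {z : X × X // z.1 ≠ z.2}]
    (h : HasAP 𝕜 (LipFree 𝕜 x₀)) : HasAP 𝕜 (LipGamma 𝕜 x₀) := by
  rw [hasAP_iff] at h ⊢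
  intro K hK V hV
  obtain ⟨C, hC, hKC⟩ := LipGamma.exists_norm_le_of_isCompact hK.2
  obtain ⟨i, hi⟩ := LipGamma.exists_seqSeminorm_subset hV
  obtain ⟨L, hL, -, hLi⟩ := LipGamma.exists_compact_seqSeminorm_le (𝕜 := 𝕜) (x₀ := x₀) i
  obtain ⟨S, hSf, hS⟩ := h L hL (Metric.closedBall 0 (1 / (C + 1)))
    (Metric.closedBall_mem_nhds _ (by positivity))
  obtain ⟨T, hT⟩ := LipFree.exists_transpose S
  refine ⟨T, finiteDimensional_range_of_transpose S.toLinearMap T.toLinearMap (pairing 𝕜 x₀)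
    (fun m f => pairing 𝕜 x₀ m f) (fun m f => hT m f)
    (fun f hf => LipGamma.ext_pairing fun m => by rw [hf, map_zero]), fun f hf => ?_⟩
  refine hi _ (hLi _ 1 fun m hm => ?_)
  rw [← pairing_apply, map_sub, hT, ← LinearMap.sub_apply, ← map_sub, pairing_apply]
  refine (LipFree.norm_apply_le _ _).trans ?_
  have h1 : ‖S m - m‖ ≤ 1 / (C + 1) := by simpa using hS m hm
  calc ‖S m - m‖ * ‖toLip0 f‖ ≤ 1 / (C + 1) * C :=
        mul_le_mul h1 (hKC f hf) (norm_nonneg _) (by positivity)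
    _ ≤ 1 := by rw [one_div, inv_mul_le_one₀ (by positivity)]; linarith

theorem polar_smul_mem_nhds {K : Set (LipFree 𝕜 x₀)} (hK : IsCompact K) {ε : ℝ} (hε : 0 < ε) :
    {f : LipGamma 𝕜 x₀ | ∀ m ∈ K, ‖pairing 𝕜 x₀ m f‖ ≤ ε} ∈ 𝓝 0 := by
  filter_upwards [LipGamma.polar_mem_nhds (hK.image (continuous_const_smul ((ε : 𝕜)⁻¹)))]
    with f hf m hm
  have h1 := hf _ ⟨m, hm, rfl⟩
  rwa [← pairing_apply, map_smul, LinearMap.smul_apply, norm_smul, norm_inv, RCLike.norm_ofReal,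
    abs_of_pos hε, inv_mul_le_one₀ hε] at h1

/-- The unit ball itself is a convex balanced compact set: approximating the identity on it, tested
against `K`, bounds `‖S m - m‖` for `m ∈ K`. -/
theorem hasAP_lipFree_of_lipGamma [Nonempty {z : X × X // z.1 ≠ z.2}]
    (h : HasAP 𝕜 (LipGamma 𝕜 x₀)) : HasAP 𝕜 (LipFree 𝕜 x₀) := by
  rw [hasAP_iff] at h ⊢
  intro K hK V hV
  obtain ⟨ε, hε, hεV⟩ := Metric.nhds_basis_closedBall.mem_iff.mp hV
  have hB : {f : LipGamma 𝕜 x₀ | ‖toLip0 f‖ ≤ 1} ∈ convexBalancedCompacts 𝕜 (LipGamma 𝕜 x₀) := by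
    refine ⟨⟨?_, ?_⟩, LipGamma.isCompact_closedBall 1 zero_le_one⟩
    · rintro c hc _ ⟨f, hf, rfl⟩
      change ‖toLip0 (c • f)‖ ≤ 1
      rw [map_smul, norm_smul]
      exact mul_le_one₀ hc (norm_nonneg _) hf
    · have hc : Convex 𝕜 (Metric.closedBall (0 : Lip0 𝕜 x₀ 𝕜) 1) := by
        let _ : NormedSpace ℝ (Lip0 𝕜 x₀ 𝕜) := NormedSpace.restrictScalars ℝ 𝕜 _
        have : IsScalarTower ℝ 𝕜 (Lip0 𝕜 x₀ 𝕜) := RestrictScalars.isScalarTower ℝ 𝕜 _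
        exact convex_RCLike_iff_convex_real.mpr (convex_closedBall 0 1)
      intro f hf g hg a b ha hb hab
      have := hc (mem_closedBall_zero_iff.mpr hf) (mem_closedBall_zero_iff.mpr hg) ha hb hab
      rwa [mem_closedBall_zero_iff] at this
  obtain ⟨T, hTf, hT⟩ := h _ hB _ (polar_smul_mem_nhds hK.2 hε)
  obtain ⟨S, hS⟩ := LipGamma.exists_transpose T
  refine ⟨S, finiteDimensional_range_of_transpose T.toLinearMap S.toLinearMap
    (pairing 𝕜 x₀).flip (fun f m => pairing 𝕜 x₀ m f) (fun f m => hS m f)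
    (fun m hm => LipFree.ext_pairing fun f => by rw [hm, map_zero, LinearMap.zero_apply]),
    fun m hm => hεV ?_⟩
  rw [mem_closedBall_zero_iff]
  refine LipFree.norm_le_of_forall fun f hf => ?_
  have h1 := hT (toLip0.symm f) hf m hm
  rwa [map_sub, ← hS, ← LinearMap.sub_apply, ← map_sub] at h1

theorem eq_of_forall_dual {y z : F} (h : ∀ φ : StrongDual 𝕜 F, φ y = φ z) : y = z := by
  refine sub_eq_zero.mp (norm_le_zero_iff.mp (norm_le_of_forall_dual (𝕜 := 𝕜) fun φ _ => ?_))
  rw [map_sub, h, sub_self, norm_zero]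

theorem dense_finiteRank_of_hasAP [Nonempty {z : X × X // z.1 ≠ z.2}] [CompleteSpace F]
    (h : HasAP 𝕜 (LipFree 𝕜 x₀)) :
    @Dense (Lip0 𝕜 x₀ F) (Lip0.gammaTau 𝕜 x₀ F) (Lip0.finiteRank 𝕜 x₀ F) := by
  rw [hasAP_iff] at h
  rw [Lip0.dense_gammaTau_iff]
  intro f i ε hε
  obtain ⟨T, hT⟩ := LipFree.exists_linearization f
  obtain ⟨L, hL, -, hLi⟩ := LipGamma.exists_compact_seqSeminorm_le (𝕜 := 𝕜) (x₀ := x₀) i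
  obtain ⟨S, hSf, hS⟩ := h L hL (Metric.closedBall 0 (ε / 2 / (‖T‖ + 1)))
    (Metric.closedBall_mem_nhds _ (by positivity))
  refine ⟨LipFree.toLip (T ∘L S), ?_, lt_of_le_of_lt ?_ (half_lt_self hε)⟩
  · have : FiniteDimensional 𝕜 ((LinearMap.range S.toLinearMap).map T.toLinearMap) := inferInstance
    refine Submodule.finiteDimensional_of_le (S₂ := (LinearMap.range S.toLinearMap).map
      T.toLinearMap) (Submodule.span_le.mpr ?_)
    rintro _ ⟨x, rfl⟩
    exact ⟨_, ⟨LipFree.point 𝕜 x₀ x, rfl⟩, rfl⟩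
  · refine Lip0.seqSeminorm_le_of_comp fun φ hφ => hLi _ _ fun m hm => ?_
    rw [map_sub, map_sub, LipFree.apply_comp_toLip, ← hT, ← map_sub]
    have h1 : ‖S m - m‖ ≤ ε / 2 / (‖T‖ + 1) := by simpa using hS m hm
    have h2 : (T ∘L S) m - T m = T (S m - m) := (map_sub T _ _).symm
    rw [h2]
    calc ‖φ (T (S m - m))‖ ≤ ‖φ‖ * ‖T (S m - m)‖ := φ.le_opNorm _
      _ ≤ 1 * (‖T‖ * ‖S m - m‖) := by
          gcongr
          exact T.le_opNorm _
      _ ≤ 1 * ((‖T‖ + 1) * (ε / 2 / (‖T‖ + 1))) := by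
          gcongr
          linarith
      _ = ε / 2 := by field_simp

/-- `F` is an isometric copy of the free space, which allows a change of universe. A finite-rank map
close to `x ↦ J δ_x` linearizes to an operator close to `J` on `K`. -/
theorem hasAP_of_dense_finiteRank [Nonempty {z : X × X // z.1 ≠ z.2}] [CompleteSpace F]
    (J : LipFree 𝕜 x₀ ≃ₗᵢ[𝕜] F)
    (h : @Dense (Lip0 𝕜 x₀ F) (Lip0.gammaTau 𝕜 x₀ F) (Lip0.finiteRank 𝕜 x₀ F)) :
    HasAP 𝕜 (LipFree 𝕜 x₀) := by
  rw [Lip0.dense_gammaTau_iff] at h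
  rw [hasAP_iff]
  intro K hK V hV
  obtain ⟨ε, hε, hεV⟩ := Metric.nhds_basis_closedBall.mem_iff.mp hV
  obtain ⟨i, hi⟩ := LipGamma.exists_seqSeminorm_subset (polar_smul_mem_nhds hK.2 hε)
  let J' : LipFree 𝕜 x₀ →L[𝕜] F := J.toContinuousLinearEquiv
  obtain ⟨g, hg, hgi⟩ := h (LipFree.toLip J') i 1 one_pos
  obtain ⟨T, hT⟩ := LipFree.exists_linearization g
  have hTg : ∀ x, T (LipFree.point 𝕜 x₀ x) = g x := fun x =>
    eq_of_forall_dual fun φ : StrongDual 𝕜 F => hT _ φ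
  have hP : FiniteDimensional 𝕜 (Submodule.span 𝕜 (Set.range g)) := hg
  -- The finite-dimensional span is closed, so the linearization stays in it beyond the points
  -- `δ_x`.
  have hTP : ∀ m, T m ∈ Submodule.span 𝕜 (Set.range g) :=
    LipFree.map_mem_of_point T (Submodule.closed_of_finiteDimensional _) fun x => by
      rw [hTg]
      exact Submodule.subset_span ⟨x, rfl⟩
  let Ji : F →L[𝕜] LipFree 𝕜 x₀ := J.symm.toContinuousLinearEquiv
  refine ⟨Ji ∘L T, ?_, fun m hm => hεV ?_⟩
  · refine Submodule.finiteDimensional_of_le (S₂ := (Submodule.span 𝕜 (Set.range g)).map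
      Ji.toLinearMap) ?_
    rintro _ ⟨m, rfl⟩
    exact ⟨T m, hTP m, rfl⟩
  · have h1 : ‖T m - J' m‖ ≤ ε := norm_le_of_forall_dual fun φ hφ => by
      have h2 : φ (T m - J' m) = (m : StrongDual 𝕜 (Lip0 𝕜 x₀ 𝕜))
          (Lip0.comp φ (g - LipFree.toLip J')) := by
        rw [map_sub φ (T m) (J' m), hT, ← LipFree.apply_comp_toLip, map_sub (Lip0.comp φ),
          map_sub (m : StrongDual 𝕜 (Lip0 𝕜 x₀ 𝕜))]
      rw [h2]
      refine hi (toLip0.symm (Lip0.comp φ (g - LipFree.toLip J'))) ?_ m hm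
      calc _ ≤ ‖φ‖ * _ := Lip0.seqSeminorm_comp_le i φ _
        _ ≤ 1 * 1 := mul_le_mul hφ hgi.le (apply_nonneg _ _) zero_le_one
        _ = 1 := one_mul 1
    have h2 : J ((Ji ∘L T) m - m) = T m - J' m := by
      rw [map_sub]
      congr 1
      exact J.apply_symm_apply _
    rw [mem_closedBall_zero_iff, ← J.norm_map, h2]
    exact h1

/-! ### Tensors as finite-rank maps, and the `ε`-product -/

theorem tensorToEps_tmul_apply {E G : Type*} [AddCommGroup E] [Module 𝕜 E] [TopologicalSpace E]
    [IsTopologicalAddGroup E] [ContinuousSMul 𝕜 E] [AddCommGroup G] [Module 𝕜 G]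
    [TopologicalSpace G] [ContinuousSMul 𝕜 G] (e : E) (y : G) (φ : DualC 𝕜 G) :
    tensorToEps 𝕜 E G (e ⊗ₜ y) φ = φ y • e := by
  rw [tensorToEps, TensorProduct.lift.tmul]
  rfl

theorem tensorToEps_sum_tmul_apply {E G ι : Type*} [AddCommGroup E] [Module 𝕜 E]
    [TopologicalSpace E] [IsTopologicalAddGroup E] [ContinuousSMul 𝕜 E] [AddCommGroup G]
    [Module 𝕜 G] [TopologicalSpace G] [ContinuousSMul 𝕜 G] (s : Finset ι) (e : ι → E) (y : ι → G)
    (φ : DualC 𝕜 G) :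
    tensorToEps 𝕜 E G (∑ k ∈ s, e k ⊗ₜ y k) φ = ∑ k ∈ s, φ (y k) • e k := by
  classical
  induction s using Finset.induction_on with
  | empty =>
    rw [Finset.sum_empty, Finset.sum_empty, map_zero]
    rfl
  | insert a s ha ih =>
    rw [Finset.sum_insert ha, Finset.sum_insert ha, map_add, ← ih, ← tensorToEps_tmul_apply]
    rfl

theorem Lip0.zero_mem_finiteRank : (0 : Lip0 𝕜 x₀ F) ∈ Lip0.finiteRank 𝕜 x₀ F := by
  refine Submodule.finiteDimensional_of_le (S₂ := ⊥) (Submodule.span_le.mpr ?_)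
  rintro _ ⟨x, rfl⟩
  exact rfl

/-- The tensor `e ⊗ y` corresponds to the map `x ↦ e(x) y`. -/
theorem exists_finiteRank_of_tensor (t : LipGamma 𝕜 x₀ ⊗[𝕜] F) :
    ∃ g ∈ Lip0.finiteRank 𝕜 x₀ F, ∀ φ : DualC 𝕜 F,
      toLip0 (tensorToEps 𝕜 (LipGamma 𝕜 x₀) F t φ) = Lip0.comp (DualC.toDual φ) g := by
  induction t using TensorProduct.induction_on with
  | zero =>
    refine ⟨0, Lip0.zero_mem_finiteRank, fun φ => ?_⟩
    rw [map_zero, map_zero]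
    exact map_zero toLip0
  | tmul e y =>
    refine ⟨Lip0.comp (ContinuousLinearMap.toSpanSingleton 𝕜 y) (toLip0 e), ?_, fun φ => ?_⟩
    · refine Submodule.finiteDimensional_of_le (S₂ := Submodule.span 𝕜 {y})
        (Submodule.span_le.mpr ?_)
      rintro _ ⟨x, rfl⟩
      exact Submodule.smul_mem _ _ (Submodule.mem_span_singleton_self y)
    · rw [tensorToEps_tmul_apply, map_smul]
      refine DFunLike.ext _ _ fun x => ?_
      rw [Lip0.smul_apply, Lip0.comp_apply, Lip0.comp_apply,
        ContinuousLinearMap.toSpanSingleton_apply, map_smul, smul_eq_mul, smul_eq_mul, mul_comm]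
      rfl
  | add t s ht hs =>
    obtain ⟨g, hg, hgt⟩ := ht
    obtain ⟨k, hk, hks⟩ := hs
    refine ⟨g + k, ?_, fun φ => ?_⟩
    · have h1 : FiniteDimensional 𝕜 (Submodule.span 𝕜 (Set.range g)) := hg
      have h2 : FiniteDimensional 𝕜 (Submodule.span 𝕜 (Set.range k)) := hk
      refine Submodule.finiteDimensional_of_le (S₂ := Submodule.span 𝕜 (Set.range g) ⊔
        Submodule.span 𝕜 (Set.range k)) (Submodule.span_le.mpr ?_)
      rintro _ ⟨x, rfl⟩
      exact Submodule.add_mem_sup (Submodule.subset_span ⟨x, rfl⟩) (Submodule.subset_span ⟨x, rfl⟩)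
    · have h : tensorToEps 𝕜 (LipGamma 𝕜 x₀) F (t + s) φ =
          tensorToEps 𝕜 (LipGamma 𝕜 x₀) F t φ + tensorToEps 𝕜 (LipGamma 𝕜 x₀) F s φ := by
        rw [map_add]
        rfl
      rw [h, map_add toLip0, hgt, hks]
      exact (map_add _ _ _).symm

/-- Expanding `g` in a basis of the span of its image, with Lipschitz coordinate functions, gives
the tensor. -/
theorem exists_tensor_of_finiteRank {g : Lip0 𝕜 x₀ F} (hg : g ∈ Lip0.finiteRank 𝕜 x₀ F) :
    ∃ t : LipGamma 𝕜 x₀ ⊗[𝕜] F, ∀ φ : DualC 𝕜 F,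
      toLip0 (tensorToEps 𝕜 (LipGamma 𝕜 x₀) F t φ) = Lip0.comp (DualC.toDual φ) g := by
  have hP : FiniteDimensional 𝕜 (Submodule.span 𝕜 (Set.range g)) := hg
  let b := Module.finBasis 𝕜 (Submodule.span 𝕜 (Set.range g))
  let g' : Lip0 𝕜 x₀ (Submodule.span 𝕜 (Set.range g)) :=
    Lip0.mk' (fun x => ⟨g x, Submodule.subset_span ⟨x, rfl⟩⟩) (Subtype.ext g.map_base) ‖g‖
      (Lip0.norm_sub_le g)
  refine ⟨∑ k, toLip0.symm (Lip0.comp (LinearMap.toContinuousLinearMap (b.coord k)) g') ⊗ₜ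
    (b k : F), fun φ => DFunLike.ext _ _ fun x => ?_⟩
  have h1 : g x = ∑ k, b.coord k (g' x) • (b k : F) := by
    have h2 := congrArg Subtype.val (b.sum_repr (g' x))
    rw [Submodule.coe_sum] at h2
    exact h2.symm
  have h3 : ∀ (s : Finset (Fin (Module.finrank 𝕜 (Submodule.span 𝕜 (Set.range g)))))
      (v : _ → Lip0 𝕜 x₀ 𝕜), (∑ k ∈ s, v k) x = ∑ k ∈ s, v k x := fun s v =>
    map_sum (Lip0.delta 𝕜 x₀ x) v s
  rw [Lip0.comp_apply, h1, tensorToEps_sum_tmul_apply, map_sum toLip0, h3, map_sum]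
  refine Finset.sum_congr rfl fun k _ => ?_
  rw [map_smul, map_smul, Lip0.smul_apply, smul_eq_mul, smul_eq_mul, mul_comm]
  rfl

/-- Every `u` comes from a Lipschitz map: `φ ↦ u(φ)(x)` is continuous on `F'_c`, hence evaluation at
some `f x` in `F`. -/
theorem denseRange_of_dense_finiteRank [Nonempty {z : X × X // z.1 ≠ z.2}]
    (h : @Dense (Lip0 𝕜 x₀ F) (Lip0.gammaTau 𝕜 x₀ F) (Lip0.finiteRank 𝕜 x₀ F)) :
    DenseRange (tensorToEps 𝕜 (LipGamma 𝕜 x₀) F) := by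
  rw [Lip0.dense_gammaTau_iff] at h
  rw [denseRange_tensorToEps_iff]
  intro u V hV
  obtain ⟨i, hi⟩ := LipGamma.exists_seqSeminorm_subset hV
  have hy : ∀ x, ∃ y : F, ∀ φ : DualC 𝕜 F, φ y = toLip0 (u φ) x := fun x =>
    DualC.exists_eq_eval (pairing 𝕜 x₀ (LipFree.point 𝕜 x₀ x) ∘ₗ u.toLinearMap)
      ((LipGamma.continuous_eval (LipFree.point 𝕜 x₀ x)).comp u.continuous)
  choose f hf using hy
  -- Compact sets are bounded, so neighbourhoods of zero in `F'_c` absorb the dual unit ball. Hence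
  -- `u` is norm-bounded on it, and norming functionals make `f` Lipschitz.
  obtain ⟨C, hC, huC⟩ := Lip0.exists_norm_le_of_seqSeminorm_bounded
    ((fun φ : DualC 𝕜 F => toLip0 (u φ)) '' {φ | ‖DualC.toDual φ‖ ≤ 1}) (fun j => by
      have h1 : {φ : DualC 𝕜 F | Lip0.seqSeminorm 𝕜 x₀ 𝕜 j (toLip0 (u φ)) ≤ 1} ∈ 𝓝 0 := by
        have h2 := u.continuous.tendsto 0
        rw [map_zero] at h2
        exact h2 (LipGamma.seqSeminorm_le_mem_nhds j)
      obtain ⟨⟨K, ε⟩, ⟨hK, hε⟩, hKε⟩ := (DualC.hasBasis_nhds_zero F).mem_iff.mp h1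
      dsimp only at hK hε hKε
      obtain ⟨R, hR, hKR⟩ := hK.2.isBounded.exists_pos_norm_le
      have hc : (0 : ℝ) < ε / R := by positivity
      refine ⟨(ε / R)⁻¹, ?_⟩
      rintro _ ⟨φ, hφ, rfl⟩
      have h3 : ((ε / R : ℝ) : 𝕜) • φ ∈
          {φ : DualC 𝕜 F | Lip0.seqSeminorm 𝕜 x₀ 𝕜 j (toLip0 (u φ)) ≤ 1} := hKε fun y hy => by
        change ((ε / R : ℝ) : 𝕜) • DualC.toDual φ y ∈ _
        rw [mem_closedBall_zero_iff, norm_smul, RCLike.norm_ofReal, abs_of_pos hc]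
        calc ε / R * ‖DualC.toDual φ y‖ ≤ ε / R * (1 * R) := by
              gcongr
              exact (ContinuousLinearMap.le_opNorm _ _).trans
                (mul_le_mul hφ (hKR y hy) (norm_nonneg _) zero_le_one)
          _ = ε := by field_simp
      rw [Set.mem_ofPred_eq, map_smul, map_smul, map_smul_eq_mul, RCLike.norm_ofReal,
        abs_of_pos hc] at h3
      rwa [← one_div, le_div_iff₀' hc])
  have hφC : ∀ φ : StrongDual 𝕜 F, ‖φ‖ ≤ 1 → ‖toLip0 (u (DualC.toDual.symm φ))‖ ≤ C :=
    fun φ hφ => huC _ ⟨DualC.toDual.symm φ, hφ, rfl⟩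
  let f' : Lip0 𝕜 x₀ F := Lip0.mk' f
    (eq_of_forall_dual fun φ : StrongDual 𝕜 F => by
      have := hf x₀ (DualC.toDual.symm φ)
      rw [Lip0.map_base] at this
      rw [map_zero]
      exact this) C fun x y => norm_le_of_forall_dual fun φ hφ => by
        have hx := hf x (DualC.toDual.symm φ)
        have hy := hf y (DualC.toDual.symm φ)
        rw [DualC.toDual_symm_apply] at hx hy
        rw [map_sub, hx, hy]
        exact (Lip0.norm_sub_le _ x y).trans (mul_le_mul_of_nonneg_right (hφC φ hφ) dist_nonneg)
  have hcomp : ∀ φ : DualC 𝕜 F, toLip0 (u φ) = Lip0.comp (DualC.toDual φ) f' := fun φ =>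
    DFunLike.ext _ _ fun x => (hf x φ).symm
  obtain ⟨g, hg, hgi⟩ := h f' i 1 one_pos
  obtain ⟨t, ht⟩ := exists_tensor_of_finiteRank hg
  refine ⟨t, fun φ hφ => hi _ ?_⟩
  rw [map_sub, ht, hcomp, ← map_sub]
  calc _ ≤ ‖DualC.toDual φ‖ * _ := Lip0.seqSeminorm_comp_le i _ _
    _ ≤ 1 * 1 := mul_le_mul hφ hgi.le (apply_nonneg _ _) zero_le_one
    _ = 1 := one_mul 1

/-- The operator `φ ↦ φ ∘ f` belongs to the `ε`-product, so a tensor approximates it on the dual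
unit ball; norming functionals turn this into a vector-valued estimate. -/
theorem dense_finiteRank_of_denseRange [Nonempty {z : X × X // z.1 ≠ z.2}] [CompleteSpace F]
    (h : DenseRange (tensorToEps 𝕜 (LipGamma 𝕜 x₀) F)) :
    @Dense (Lip0 𝕜 x₀ F) (Lip0.gammaTau 𝕜 x₀ F) (Lip0.finiteRank 𝕜 x₀ F) := by
  rw [Lip0.dense_gammaTau_iff]
  rw [denseRange_tensorToEps_iff] at h
  intro f i ε hε
  let u : DualC 𝕜 F →ₗ[𝕜] LipGamma 𝕜 x₀ :=
    { toFun := fun φ => toLip0.symm (Lip0.comp (DualC.toDual φ) f)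
      map_add' := fun _ _ => rfl
      map_smul' := fun _ _ => rfl }
  have hu : Continuous u := continuous_of_continuousAt_zero u fun V hV => by
    rw [map_zero] at hV
    obtain ⟨j, hj⟩ := LipGamma.exists_seqSeminorm_subset hV
    -- The weighted difference quotients of `f` form a null sequence in `F`; the polar of its
    -- compact hull is mapped into the seminorm ball.
    obtain ⟨K, hK, hKn⟩ := exists_nullSeq_compact (𝕜 := 𝕜) j.1.2.2
      (fun n => ((dist (j.2 n).1.1 (j.2 n).1.2 : ℝ) : 𝕜)⁻¹ •
        (f (j.2 n).1.1 - f (j.2 n).1.2)) (C := ‖f‖) (fun n => by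
          rw [norm_smul, norm_inv, RCLike.norm_ofReal, abs_of_nonneg dist_nonneg, ← div_eq_inv_mul]
          exact Lip0.slope_le_norm f (j.2 n))
    refine Filter.mem_map.mpr ?_
    filter_upwards [(DualC.hasBasis_nhds_zero F).mem_of_mem (i := (K, 1)) ⟨hK, one_pos⟩] with φ hφ
    refine hj _ ((Lip0.seqSeminorm_le_iff j _ 1).mpr fun n => ?_)
    have h1 := hφ _ (hKn n)
    change DualC.toDual φ _ ∈ _ at h1
    rw [mem_closedBall_zero_iff, map_smul, map_smul, norm_smul, norm_smul, norm_inv,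
      RCLike.norm_ofReal, RCLike.norm_ofReal, abs_of_nonneg dist_nonneg, abs_of_pos (j.1.2.1 n),
      ← div_eq_inv_mul, map_sub] at h1
    exact h1
  obtain ⟨t, ht⟩ := h ⟨u, hu⟩ {f | Lip0.seqSeminorm 𝕜 x₀ 𝕜 i (toLip0 f) ≤ ε / 2} (by
    refine (LipGamma.continuous_seqSeminorm i).continuousAt.eventually (eventually_le_nhds ?_)
    change Lip0.seqSeminorm 𝕜 x₀ 𝕜 i (toLip0 0) < ε / 2
    rw [map_zero, map_zero]
    exact half_pos hε)
  obtain ⟨g, hg, hgt⟩ := exists_finiteRank_of_tensor t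
  refine ⟨g, hg, lt_of_le_of_lt (Lip0.seqSeminorm_le_of_comp fun φ hφ => ?_) (half_lt_self hε)⟩
  have h1 := ht (DualC.toDual.symm φ) hφ
  rw [Set.mem_ofPred_eq, map_sub, hgt] at h1
  rw [map_sub]
  exact h1

end Main

/-! ### The one-point space and the conclusion -/

theorem hasAP_of_subsingleton {𝕜 : Type*} [RCLike 𝕜] {E : Type*} [AddCommGroup E] [Module 𝕜 E]
    [TopologicalSpace E] [IsTopologicalAddGroup E] [ContinuousSMul 𝕜 E] [Subsingleton E] :
    HasAP 𝕜 E := by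
  rw [hasAP_iff]
  intro K _ V hV
  refine ⟨0, inferInstance, fun x _ => ?_⟩
  rw [Subsingleton.elim ((0 : E →L[𝕜] E) x - x) 0]
  exact mem_of_mem_nhds hV

theorem Lip0.subsingleton_of_isEmpty {𝕜 : Type*} [RCLike 𝕜] {X : Type*} [MetricSpace X] {x₀ : X}
    {F : Type*} [NormedAddCommGroup F] [NormedSpace 𝕜 F]
    (h : IsEmpty {z : X × X // z.1 ≠ z.2}) : Subsingleton (Lip0 𝕜 x₀ F) := by
  refine ⟨fun f g => DFunLike.ext _ _ fun x => ?_⟩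
  have hx : x = x₀ := by
    by_contra hx
    exact h.false ⟨(x, x₀), hx⟩
  rw [hx, f.map_base, g.map_base]

theorem mainTheorem1 {𝕜 : Type w} [RCLike 𝕜] {X : Type v} [MetricSpace X] (x₀ : X) :
    List.TFAE [
      HasAP 𝕜 (LipGamma 𝕜 x₀),
      HasAP 𝕜 (LipFree 𝕜 x₀),
      ∀ (F : Type (max u v w)) [NormedAddCommGroup F] [NormedSpace 𝕜 F] [CompleteSpace F],
        DenseRange (tensorToEps 𝕜 (LipGamma 𝕜 x₀) F),
      ∀ (F : Type (max u v w)) [NormedAddCommGroup F] [NormedSpace 𝕜 F] [CompleteSpace F],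
        @Dense (Lip0 𝕜 x₀ F) (Lip0.gammaTau 𝕜 x₀ F) (Lip0.finiteRank 𝕜 x₀ F)] := by
  rcases isEmpty_or_nonempty {z : X × X // z.1 ≠ z.2} with hX | hX
  · have h1 : Subsingleton (Lip0 𝕜 x₀ 𝕜) := Lip0.subsingleton_of_isEmpty hX
    have h2 : Subsingleton (LipGamma 𝕜 x₀) := h1
    have h3 : Subsingleton (LipFree 𝕜 x₀) :=
      ⟨fun m n => Subtype.ext (ContinuousLinearMap.ext fun f => by
        rw [Subsingleton.elim f 0, map_zero, map_zero])⟩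
    tfae_have 1 → 2 := fun _ => hasAP_of_subsingleton
    tfae_have 2 → 3 := fun _ F _ _ _ u => by
      have : u = tensorToEps 𝕜 (LipGamma 𝕜 x₀) F 0 :=
        DFunLike.ext _ _ fun φ => Subsingleton.elim _ _
      rw [this]
      exact subset_closure ⟨0, rfl⟩
    tfae_have 3 → 4 := fun _ F _ _ _ f => by
      have h4 : Subsingleton (Lip0 𝕜 x₀ F) := Lip0.subsingleton_of_isEmpty hX
      refine @subset_closure _ (Lip0.gammaTau 𝕜 x₀ F) _ _ ?_
      rw [Subsingleton.elim f 0]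
      exact Lip0.zero_mem_finiteRank
    tfae_have 4 → 1 := fun _ => hasAP_of_subsingleton
    tfae_finish
  · tfae_have 1 → 2 := hasAP_lipFree_of_lipGamma
    tfae_have 2 → 1 := hasAP_lipGamma_of_lipFree
    tfae_have 2 → 4 := fun h F _ _ _ => dense_finiteRank_of_hasAP h
    -- The test space is the free space itself, lifted to the universe over which `F` ranges.
    tfae_have 4 → 2 := fun h =>
      hasAP_of_dense_finiteRank (LinearIsometryEquiv.ulift 𝕜 (LipFree 𝕜 x₀)).symm 
        (h (ULift.{u} (LipFree 𝕜 x₀)))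
    tfae_have 4 → 3 := fun h F _ _ _ => denseRange_of_dense_finiteRank (h F)
    tfae_have 3 → 4 := fun h F _ _ _ => dense_finiteRank_of_denseRange (h F)
    tfae_finish
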